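/- All manifolds and maps are smooth; manifolds are Hausdorff and may have boundary. Let $Y^3$ be a submanifold of a 5-manifold $W^5$, let $\gamma\subset Y$ be an embedded circle, and let $\Delta\subset W$ be an embedded closed 2-disk with $\partial\Delta=\gamma$ and $\mathring\Delta\cap Y=\emptyset$. Let $R\subset W$ be an embedded 2-sphere with trivial normal bundle $N_W(R)=TW|_R/TR$ that is disjoint from $\Delta$ and from $Y$. Let $\widetilde\Delta$ be an embedded disk obtained from $\Delta$ by tubing $\Delta$ to $R$: for some smooth coordinates $(x,z,w)\in\{x\in\mathbb R^2:|x|<2\}\times(-1,2)\times\{w\in\mathbb R^2:|w|<1\}$ on an open subset of $W\setminus\gamma$, which $\Delta$ meets exactly in $\{z=0,\,w=0\}$ and $R$ exactly in $\{z=1,\,w=0\}$, the disk $\widetilde\Delta$ is obtained from $\Delta\cup R$ by removing the open disks $\{|x|<1,\,z=0,\,w=0\}$ and $\{|x|<1,\,z=1,\,w=0\}$ and gluing in a tube with rounded corners around the arc $\{x=0,\,w=0,\,0\le z\le1\}$, that is, a surface of revolution $\{w=0,\ (|x|,z)\in c\}$, where $c$ is an arc from $(1,0)$ to $(1,1)$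 whose interior lies in $(0,1)\times[0,1]$ and which, together with the rays $[1,\infty)\times\{0\}$ and $[1,\infty)\times\{1\}$, forms a smooth embedded curve. Assume that $\partial\widetilde\Delta=\gamma$ and that the interior of $\widetilde\Delta$ is disjoint from $Y$. For a disk $D\in\{\Delta,\widetilde\Delta\}$ with normal bundle $N_W(D)=TW|_D/TD$, a framing $\phi=(\phi_1,\phi_2)$ of $N_Y(\gamma)=TY|_\gamma/T\gamma$ is called $D$-admissible if there is a 2-dimensional subbundle $B\subset N_W(D)$ with a framing that extends $\phi$ (under the natural map $N_Y(\gamma)\to N_W(D)|_\gamma$). Then a framing $\phi$ of $N_Y(\gamma)$ is $\Delta$-admissible if and only if it is $\widetilde\Delta$-admissible. -/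

import Mathlib

open Set Metric
open scoped Manifold ContDiff

namespace Tubing

/-- Euclidean `n`-space. -/
abbrev Euc (n : ℕ) : Type := EuclideanSpace ℝ (Fin n)

/-- The closed unit disk `D²` as a subset of the plane. -/
abbrev disk : Set (Euc 2) := closedBall 0 1

/-- The unit circle `S¹`. -/
abbrev Circ : Type := sphere (0 : Euc 2) 1

/-- The unit sphere `S²`. -/
abbrev Sph : Type := sphere (0 : Euc 3) 1

section Normal

variable {E H M E' H' N : Type*}
  [NormedAddCommGroup E] [NormedSpace ℝ E] [TopologicalSpace H]
  [TopologicalSpace M] [ChartedSpace H M]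
  [NormedAddCommGroup E'] [NormedSpace ℝ E'] [TopologicalSpace H']
  [TopologicalSpace N] [ChartedSpace H' N]

/-- The tangent space of the image of `f : S → N` at `f x`, i.e. the image of the differential,
where `S` is a subset of the manifold `M` (one-sided derivatives at the boundary of `S`). -/
noncomputable def tangentImage (J : ModelWithCorners ℝ E H) (I : ModelWithCorners ℝ E' H')
    (f : M → N) (S : Set M) (x : M) : Submodule ℝ (TangentSpace I (f x)) :=
  LinearMap.range (mfderivWithin J I f S x).toLinearMap

/-- The fibre at `x` of the normal bundle of `f : S → N`: the quotient `T_{f x}N / df(T_x S)`. -/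
abbrev NormalSpace (J : ModelWithCorners ℝ E H) (I : ModelWithCorners ℝ E' H')
    (f : M → N) (S : Set M) (x : M) : Type _ :=
  TangentSpace I (f x) ⧸ tangentImage J I f S x

/-- A section of the normal bundle of `f` over `S` is smooth if it is represented by a smooth
vector field along `f`, i.e. if it is the image of a smooth section of `f^* TN` over `S`.
Values of `s` outside `S` are irrelevant. -/
def IsSmoothSection (J : ModelWithCorners ℝ E H) (I : ModelWithCorners ℝ E' H') [IsManifold I ∞ N]
    (f : M → N) (S : Set M) (s : ∀ x, NormalSpace J I f S x) : Prop :=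
  ∃ V : ∀ x, TangentSpace I (f x),
    ContMDiffOn J I.tangent ∞ (fun x ↦ (⟨f x, V x⟩ : TangentBundle I N)) S ∧
      ∀ x ∈ S, s x = Submodule.Quotient.mk (V x)

/-- `φ` is a framing (trivialization) of the rank `k` subbundle `B` of the normal bundle of `f`
over `S`: `k` smooth sections that form a basis of `B x` for each `x ∈ S`. (This forces `B` to be
a smooth subbundle of rank `k`.) -/
structure IsFraming (J : ModelWithCorners ℝ E H) (I : ModelWithCorners ℝ E' H') [IsManifold I ∞ N]
    (f : M → N) (S : Set M) (B : ∀ x, Submodule ℝ (NormalSpace J I f S x)) {k : ℕ}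
    (φ : Fin k → ∀ x, NormalSpace J I f S x) : Prop where
  smooth : ∀ i, IsSmoothSection J I f S (φ i)
  linearIndependent : ∀ x ∈ S, LinearIndependent ℝ (fun i ↦ φ i x)
  span_eq : ∀ x ∈ S, Submodule.span ℝ (range fun i ↦ φ i x) = B x

/-- The normal bundle of `f : M → N`, of rank `k`, is trivial: it has a global framing. -/
def HasTrivialNormalBundle (J : ModelWithCorners ℝ E H) (I : ModelWithCorners ℝ E' H')
    [IsManifold I ∞ N] (k : ℕ) (f : M → N) : Prop :=
  ∃ φ : Fin k → ∀ x, NormalSpace J I f univ x, IsFraming J I f univ (fun _ ↦ ⊤) φ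

end Normal

section Surgery

variable {H W H' Y : Type*}
  [TopologicalSpace H] [TopologicalSpace W] [ChartedSpace H W]
  [TopologicalSpace H'] [TopologicalSpace Y] [ChartedSpace H' Y]

/-- `f : D² → W` is a smooth embedding of the closed disk: smooth up to the boundary, with
everywhere injective differential, and injective (hence an embedding, as `D²` is compact). -/
structure IsEmbeddedDisk (I : ModelWithCorners ℝ (Euc 5) H) (f : Euc 2 → W) : Prop where
  smooth : ContMDiffOn 𝓘(ℝ, Euc 2) I ∞ f disk
  injOn : InjOn f disk
  immersive : ∀ x ∈ disk, Function.Injective (mfderivWithin 𝓘(ℝ, Euc 2) I f disk x)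

/-- `f : D² → W` is an embedded disk whose boundary is the circle `γ ⊂ Y` and whose interior is
disjoint from `Y`; here `Y` is a submanifold of `W` through `ι : Y → W`. -/
structure IsSpanningDisk (I : ModelWithCorners ℝ (Euc 5) H) (ι : Y → W) (γ : Circ → Y)
    (f : Euc 2 → W) : Prop where
  embedded : IsEmbeddedDisk I f
  boundary_eq : f '' sphere 0 1 = range (ι ∘ γ)
  interior_disjoint : Disjoint (f '' ball 0 1) (range ι)

/-- A pair `φ` of sections of the normal bundle `N_Y(γ)`. -/
abbrev NormalPair (J : ModelWithCorners ℝ (Euc 3) H') (γ : Circ → Y) : Type _ :=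
  Fin 2 → ∀ θ, NormalSpace (𝓡 1) J γ univ θ

/-- The framing `φ` of `N_Y(γ)` is admissible for the disk `f`, where `∂f = γ`: there is a
subbundle `B` of rank 2 of the normal bundle `N_W(f)` with a framing `Φ` that extends `φ` under the
natural map `N_Y(γ) = TY/Tγ → TW/Tf = N_W(f)` over `γ`. The last clause says that `Φ i x` is the
image of `φ i θ` where `x ∈ ∂D²` and `θ` correspond to the same point of `γ`. -/
def IsAdmissible (J : ModelWithCorners ℝ (Euc 3) H') (I : ModelWithCorners ℝ (Euc 5) H)
    [IsManifold I ∞ W] (ι : Y → W) (γ : Circ → Y) (f : Euc 2 → W) (φ : NormalPair J γ) : Prop :=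
  ∃ (B : ∀ x, Submodule ℝ (NormalSpace 𝓘(ℝ, Euc 2) I f disk x))
    (Φ : Fin 2 → ∀ x, NormalSpace 𝓘(ℝ, Euc 2) I f disk x),
    IsFraming 𝓘(ℝ, Euc 2) I f disk B Φ ∧
      ∀ x ∈ sphere (0 : Euc 2) 1, ∀ θ : Circ, f x = ι (γ θ) →
        ∀ (i : Fin 2) (v : TangentSpace J (γ θ)), Submodule.Quotient.mk v = φ i θ →
          Φ i x = Submodule.Quotient.mk (show TangentSpace I (f x) from mfderiv J I ι (γ θ) v)

/-- Local model of a neighbourhood of the tube, with coordinates `(x, z, w) ∈ ℝ² × ℝ × ℝ²`. The arc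
is `x = 0, w = 0, 0 ≤ z ≤ 1`, the disk is `z = 0, w = 0`, the sphere is `z = 1, w = 0`. -/
abbrev Model : Type := Euc 2 × ℝ × Euc 2

/-- The domain of the local model. -/
def modelBox : Set Model := {q | ‖q.1‖ < 2 ∧ -1 < q.2.1 ∧ q.2.1 < 2 ∧ ‖q.2.2‖ < 1}

/-- The open unit disk around the axis at height `h`. -/
def modelDisk (h : ℝ) : Set Model := {q | ‖q.1‖ < 1 ∧ q.2.1 = h ∧ q.2.2 = 0}

/-- A profile of a tube with rounded corners: `t ↦ (r t, z t)` is a smooth regular simple curve in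
the half plane `r > 0` that comes in along the line `z = 0` until `r = 1`, stays in
`0 < r < 1, 0 ≤ z ≤ 1` and goes out along `z = 1` from `r = 1` on. -/
structure IsTubeProfile (r z : ℝ → ℝ) : Prop where
  smooth_r : ContDiff ℝ ∞ r
  smooth_z : ContDiff ℝ ∞ z
  regular : ∀ t, deriv r t ≠ 0 ∨ deriv z t ≠ 0
  injective : Function.Injective fun t ↦ (r t, z t)
  incoming : ∀ t ≤ -1, r t = -t ∧ z t = 0
  outgoing : ∀ t, 1 ≤ t → r t = t ∧ z t = 1
  middle : ∀ t, -1 < t → t < 1 → 0 < r t ∧ r t < 1 ∧ 0 ≤ z t ∧ z t ≤ 1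

/-- The tube: the surface of revolution of the profile around the axis, in `w = 0`. -/
def modelTube (r z : ℝ → ℝ) : Set Model :=
  {q | ∃ t ∈ Icc (-1 : ℝ) 1, ‖q.1‖ = r t ∧ q.2.1 = z t ∧ q.2.2 = 0}

/-- `f'` is a disk obtained by tubing the disk `f` to the sphere `R` along a framed arc: the framed
arc is given with a neighbourhood by a diffeomorphism `Ψ` from the box onto an open subset of `W`,
in which the disk and the sphere are the planes `z = 0, w = 0` and `z = 1, w = 0`; a small open disk
around each end of the arc is removed from the disk and the sphere, and the tube (with rounded
corners) is glued in. The arc stays away from the boundary of the disk, and `f'` is an embedded disk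
that has the resulting surface as its image and the same boundary as `f`. -/
def IsTubing (I : ModelWithCorners ℝ (Euc 5) H) (f : Euc 2 → W) (R : Sph → W) (f' : Euc 2 → W) :
    Prop :=
  IsEmbeddedDisk I f' ∧ f' '' sphere 0 1 = f '' sphere 0 1 ∧
  ∃ (Ψ : OpenPartialHomeomorph Model W) (r z : ℝ → ℝ),
    Ψ.source = modelBox ∧
    ContMDiffOn 𝓘(ℝ, Model) I ∞ Ψ Ψ.source ∧
    ContMDiffOn I 𝓘(ℝ, Model) ∞ Ψ.symm Ψ.target ∧
    (∀ q ∈ modelBox, Ψ q ∈ f '' disk ↔ q.2.1 = 0 ∧ q.2.2 = 0) ∧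
    (∀ q ∈ modelBox, Ψ q ∈ range R ↔ q.2.1 = 1 ∧ q.2.2 = 0) ∧
    Disjoint Ψ.target (f '' sphere 0 1) ∧
    IsTubeProfile r z ∧
    f' '' disk = (f '' disk \ Ψ '' modelDisk 0) ∪ (range R \ Ψ '' modelDisk 1) ∪
      Ψ '' modelTube r z

end Surgery

end Tubing

open Tubing

namespace Tubing

open Filter Topology Bundle

/-! ### Lifting smooth maps through immersions of vector spaces -/

section Immersion

variable {E F G : Type*} [NormedAddCommGroup E] [NormedSpace ℝ E] [FiniteDimensional ℝ E]
  [NormedAddCommGroup F] [NormedSpace ℝ F] [FiniteDimensional ℝ F]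
  [NormedAddCommGroup G] [NormedSpace ℝ G]

/-- If `f ∘ g = h` with `f` and `h` smooth, `f` immersive at `g x` and `g` continuous, then `g` is
smooth at `x`. All maps are only considered on sets with unique derivatives. -/
theorem contDiffWithinAt_of_comp_immersion {f : E → F} {g : G → E} {h : G → F} {S : Set E}
    {T : Set G} {x : G} (hx : x ∈ T) (hS : UniqueDiffOn ℝ S) (hT : UniqueDiffOn ℝ T)
    (hf : ContDiffOn ℝ ∞ f S) (hg : ContinuousOn g T) (hgT : MapsTo g T S)
    (hh : ContDiffOn ℝ ∞ h T) (heq : ∀ y ∈ T, f (g y) = h y)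
    (hinj : Function.Injective (fderivWithin ℝ f S (g x))) : ContDiffWithinAt ℝ ∞ g T x := by
  obtain ⟨p, hp⟩ := LinearMap.exists_leftInverse_of_injective
    (fderivWithin ℝ f S (g x)).toLinearMap (LinearMap.ker_eq_bot.2 hinj)
  let P : F →L[ℝ] E := LinearMap.toContinuousLinearMap p
  -- `P` inverts the differential from the left only at `g x`, but `A` is the identity there and
  -- hence invertible at all nearby `g y`.
  let A : E → E →L[ℝ] E := fun y ↦ P ∘L fderivWithin ℝ f S y
  have hA : ContDiffOn ℝ ∞ A S :=
    contDiffOn_const.clm_comp (hf.fderivWithin hS le_rfl)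
  have hA1 : A (g x) = (ContinuousLinearEquiv.refl ℝ E : E →L[ℝ] E) := by
    ext v
    exact LinearMap.congr_fun hp v
  have hcont : ContinuousOn (fun y ↦ A (g y)) T := hA.continuousOn.comp hg hgT
  have hev : ∀ᶠ y in 𝓝[T] x, A (g y) ∈ range ((↑) : (E ≃L[ℝ] E) → E →L[ℝ] E) := by
    refine (hcont x hx).eventually_mem ?_
    exact ContinuousLinearEquiv.isOpen.mem_nhds ⟨_, hA1.symm⟩
  obtain ⟨u, hu, hxu, huT⟩ := mem_nhdsWithin.1 hev
  have hT' : UniqueDiffOn ℝ (T ∩ u) := hT.inter hu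
  -- Bootstrapping: the derivative of `g` is `A(g y)⁻¹ ∘ P ∘ dh`, which is of class `C^n` as soon as
  -- `g` is, so that `g` gains one derivative.
  have key : ∀ n : ℕ, ContDiffOn ℝ n g (T ∩ u) := by
    intro n
    induction n with
    | zero => exact contDiffOn_zero.2 (hg.mono inter_subset_left)
    | succ n ih =>
      rw [Nat.cast_succ]
      refine (contDiffOn_succ_iff_hasFDerivWithinAt_of_uniqueDiffOn (n := (n : ℕ∞ω)) hT').2
        ⟨fun h ↦ absurd h (WithTop.natCast_ne_top n),
          fun y ↦ (ContinuousLinearMap.inverse (A (g y)) ∘L P) ∘L fderivWithin ℝ h T y,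
          ?_, ?_⟩
      · refine ContDiffOn.clm_comp (ContDiffOn.clm_comp ?_ contDiffOn_const) ?_
        · intro y hy
          obtain ⟨e, he⟩ := huT ⟨hy.2, hy.1⟩
          refine ContDiffAt.comp_contDiffWithinAt y
            (g := ContinuousLinearMap.inverse) (f := fun y ↦ A (g y)) ?_ ?_
          · rw [← he]; exact contDiffAt_map_inverse e
          · exact ((hA.of_le (by exact_mod_cast le_top)).comp ih
              fun z hz ↦ hgT hz.1) y hy
        · exact ((hh.fderivWithin (m := ∞) hT le_rfl).of_le (by exact_mod_cast le_top)).mono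
            inter_subset_left
      · intro y hy
        obtain ⟨e, he⟩ := huT ⟨hy.2, hy.1⟩
        have hd : HasFDerivWithinAt f (fderivWithin ℝ f S (g y)) S (g y) :=
          ((hf.differentiableOn (by simp)) _ (hgT hy.1)).hasFDerivWithinAt
        have hd' : HasFDerivWithinAt h (fderivWithin ℝ h T y) (T ∩ u) y :=
          (((hh.differentiableOn (by simp)) _ hy.1).hasFDerivWithinAt).mono inter_subset_left
        refine HasFDerivWithinAt.of_comp_of_leftInverse (t := S) ?_ hd hd' ?_ ?_ hy
        · exact ((hg.mono inter_subset_left) y hy).tendsto_nhdsWithin fun z hz ↦ hgT hz.1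
        · filter_upwards [self_mem_nhdsWithin] with z hz using heq z hz.1
        · intro v
          change ContinuousLinearMap.inverse (A (g y)) (A (g y) v) = v
          rw [← he]
          simp
  have : ContDiffOn ℝ ∞ g (T ∩ u) := contDiffOn_infty.2 key
  exact (this x ⟨hx, hxu⟩).mono_of_mem_nhdsWithin
    (inter_mem_nhdsWithin _ (hu.mem_nhds hxu))

end Immersion

/-- A left inverse of a continuous injective map on a compact set is continuous. -/
theorem continuousOn_of_comp_injOn {X Y Z : Type*} [TopologicalSpace X] [TopologicalSpace Y]
    [T2Space Y] [TopologicalSpace Z] {f : X → Y} {g : Z → X} {K : Set X} {T : Set Z}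
    (hK : IsCompact K) (hf : ContinuousOn f K) (hinj : InjOn f K) (hg : MapsTo g T K)
    (hfg : ContinuousOn (fun z ↦ f (g z)) T) : ContinuousOn g T := by
  have : CompactSpace K := isCompact_iff_compactSpace.1 hK
  have he : IsEmbedding (K.domRestrict f) :=
    (Continuous.isClosedEmbedding hf.domRestrict hinj.injective).isEmbedding
  rw [continuousOn_iff_continuous_domRestrict] at hfg ⊢
  have h : Continuous fun z : T ↦ (⟨g z, hg z.2⟩ : K) := he.continuous_iff.2 hfg
  exact continuous_subtype_val.comp h

/-! ### Smooth vector fields along a map -/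

section Along

variable {E H M E' H' N : Type*}
  [NormedAddCommGroup E] [NormedSpace ℝ E] [TopologicalSpace H]
  [TopologicalSpace M] [ChartedSpace H M]
  [NormedAddCommGroup E'] [NormedSpace ℝ E'] [TopologicalSpace H']
  [TopologicalSpace N] [ChartedSpace H' N]
  {J : ModelWithCorners ℝ E H} {I : ModelWithCorners ℝ E' H'}

theorem tangentBundle_mk_eq {p q : N} (h : p = q) (v : E') :
    (⟨p, v⟩ : TangentBundle I N) = ⟨q, v⟩ := by
  subst h; rfl

theorem eventually_mem_chartAt_source {f : M → N} {S : Set M} {x : M}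
    (hf : ContinuousWithinAt f S x) : ∀ᶠ y in 𝓝[S] x, f y ∈ (chartAt H' (f x)).source :=
  hf.eventually_mem ((chartAt H' (f x)).open_source.mem_nhds (mem_chart_source H' (f x)))

variable [IsManifold I ∞ N]

/-- `V` is a smooth vector field along `f` on `S`. Tangent vectors of `N` are regarded as elements
of the model space, to which all tangent spaces are definitionally equal. -/
def SmoothAlong (J : ModelWithCorners ℝ E H) (I : ModelWithCorners ℝ E' H') [IsManifold I ∞ N]
    (f : M → N) (V : M → E') (S : Set M) : Prop :=
  ContMDiffOn J I.tangent ∞ (fun x ↦ (⟨f x, V x⟩ : TangentBundle I N)) S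

/-- The coordinates of tangent vectors at `q` in the trivialization of the tangent bundle
at `p`. -/
noncomputable def tangentCoord (I : ModelWithCorners ℝ E' H') [IsManifold I ∞ N] (p q : N) :
    E' →L[ℝ] E' :=
  (trivializationAt E' (TangentSpace I) p).continuousLinearMapAt ℝ q

/-- The inverse of `tangentCoord`. -/
noncomputable def tangentCoordSymm (I : ModelWithCorners ℝ E' H') [IsManifold I ∞ N] (p q : N) :
    E' →L[ℝ] E' :=
  (trivializationAt E' (TangentSpace I) p).symmL ℝ q

theorem tangentCoordSymm_tangentCoord {p q : N} (hq : q ∈ (chartAt H' p).source) (v : E') :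
    tangentCoordSymm I p q (tangentCoord I p q v) = v :=
  (trivializationAt E' (TangentSpace I) p).symmL_continuousLinearMapAt (R := ℝ) hq v

theorem tangentCoord_tangentCoordSymm {p q : N} (hq : q ∈ (chartAt H' p).source) (v : E') :
    tangentCoord I p q (tangentCoordSymm I p q v) = v :=
  (trivializationAt E' (TangentSpace I) p).continuousLinearMapAt_symmL (R := ℝ) hq v

/-- Smoothness at `x` is tested in the single trivialization at `f x`, which is linear on fibres;
the rules for sums and multiples follow from those for functions. -/
theorem contMDiffWithinAt_along_iff {f : M → N} {V : M → E'} {S : Set M} {x : M} (hx : x ∈ S)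
    (hf : ContMDiffWithinAt J I ∞ f S x) :
    ContMDiffWithinAt J I.tangent ∞ (fun y ↦ (⟨f y, V y⟩ : TangentBundle I N)) S x ↔
      ContMDiffWithinAt J 𝓘(ℝ, E') ∞ (fun y ↦ tangentCoord I (f x) (f y) (V y)) S x := by
  rw [contMDiffWithinAt_totalSpace]
  have : (fun y ↦ (trivializationAt E' (TangentSpace I) (f x)
      (⟨f y, V y⟩ : TangentBundle I N)).2) =ᶠ[𝓝[S] x]
        fun y ↦ tangentCoord I (f x) (f y) (V y) := by
    filter_upwards [eventually_mem_chartAt_source (H' := H') hf.continuousWithinAt] with y hy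
    exact (congrFun ((trivializationAt E' (TangentSpace I) (f x)).coe_linearMapAt_of_mem
      (R := ℝ) hy) (V y)).symm
  simp only [hf, true_and]
  exact this.contMDiffWithinAt_iff (this.self_of_nhdsWithin hx)

theorem SmoothAlong.contMDiffOn {f : M → N} {V : M → E'} {S : Set M}
    (h : SmoothAlong J I f V S) : ContMDiffOn J I ∞ f S :=
  fun x hx ↦ (contMDiffWithinAt_totalSpace.1 (h x hx)).1

theorem SmoothAlong.mono {f : M → N} {V : M → E'} {S T : Set M}
    (h : SmoothAlong J I f V S) (hT : T ⊆ S) : SmoothAlong J I f V T :=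
  ContMDiffOn.mono h hT

theorem SmoothAlong.add {f : M → N} {V U : M → E'} {S : Set M}
    (hV : SmoothAlong J I f V S) (hU : SmoothAlong J I f U S) :
    SmoothAlong J I f (fun x ↦ V x + U x) S := by
  intro x hx
  have hf := hV.contMDiffOn x hx
  have h1 := (contMDiffWithinAt_along_iff hx hf).1 (hV x hx)
  have h2 := (contMDiffWithinAt_along_iff hx hf).1 (hU x hx)
  refine (contMDiffWithinAt_along_iff hx hf).2 ?_
  simp only [map_add]
  exact h1.add h2

theorem SmoothAlong.smul {f : M → N} {V : M → E'} {a : M → ℝ} {S : Set M}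
    (ha : ContMDiffOn J 𝓘(ℝ, ℝ) ∞ a S) (hV : SmoothAlong J I f V S) :
    SmoothAlong J I f (fun x ↦ a x • V x) S := by
  intro x hx
  have hf := hV.contMDiffOn x hx
  refine (contMDiffWithinAt_along_iff hx hf).2 ?_
  simp only [map_smul]
  exact (ha x hx).smul ((contMDiffWithinAt_along_iff hx hf).1 (hV x hx))

theorem smoothAlong_zero {f : M → N} {S : Set M} (hf : ContMDiffOn J I ∞ f S) :
    SmoothAlong J I f (fun _ ↦ 0) S := by
  intro x hx
  refine (contMDiffWithinAt_along_iff hx (hf x hx)).2 ?_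
  simp only [map_zero]
  exact contMDiffWithinAt_const

theorem SmoothAlong.sum {κ : Type*} {f : M → N} {S : Set M} (hf : ContMDiffOn J I ∞ f S)
    (s : Finset κ) {V : κ → M → E'} (hV : ∀ i ∈ s, SmoothAlong J I f (V i) S) :
    SmoothAlong J I f (fun x ↦ ∑ i ∈ s, V i x) S := by
  classical
  induction s using Finset.induction_on with
  | empty => simpa using smoothAlong_zero hf
  | insert i s hi ih =>
    simp only [Finset.sum_insert hi]
    exact (hV i (by simp)).add (ih fun j hj ↦ hV j (by simp [hj]))

theorem SmoothAlong.congr {f f' : M → N} {V V' : M → E'} {S : Set M}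
    (h : SmoothAlong J I f V S) (hf : ∀ x ∈ S, f' x = f x) (hV : ∀ x ∈ S, V' x = V x) :
    SmoothAlong J I f' V' S :=
  ContMDiffOn.congr h fun x hx ↦ by
    rw [hV x hx]; exact tangentBundle_mk_eq (hf x hx) _

/-- Vector fields along a map can be pulled back. -/
theorem SmoothAlong.comp {E'' H'' M' : Type*} [NormedAddCommGroup E''] [NormedSpace ℝ E'']
    [TopologicalSpace H''] [TopologicalSpace M'] [ChartedSpace H'' M']
    {J' : ModelWithCorners ℝ E'' H''} {f : M → N} {V : M → E'} {S : Set M} {g : M' → M}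
    {T : Set M'} (h : SmoothAlong J I f V S) (hg : ContMDiffOn J' J ∞ g T) (hgT : MapsTo g T S) :
    SmoothAlong J' I (fun x ↦ f (g x)) (fun x ↦ V (g x)) T :=
  ContMDiffOn.comp (t := S) h hg hgT

/-- The differential of `f`, with values in the model space. -/
noncomputable def differential (J : ModelWithCorners ℝ E H) (I : ModelWithCorners ℝ E' H')
    (f : M → N) (S : Set M) (x : M) : E →L[ℝ] E' :=
  mfderivWithin J I f S x

/-- The differential of a smooth map maps smooth vector fields to smooth vector fields. -/
theorem SmoothAlong.map_differential [IsManifold J ∞ M] {E'' H'' M' : Type*}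
    [NormedAddCommGroup E''] [NormedSpace ℝ E'']
    [TopologicalSpace H''] [TopologicalSpace M'] [ChartedSpace H'' M']
    {J' : ModelWithCorners ℝ E'' H''} {f : M → N} {S : Set M} {g : M' → M} {V : M' → E}
    {T : Set M'} (hf : ContMDiffOn J I ∞ f S) (hS : UniqueMDiffOn J S)
    (hV : SmoothAlong J' J g V T) (hg : MapsTo g T S) :
    SmoothAlong J' I (fun x ↦ f (g x)) (fun x ↦ differential J I f S (g x) (V x)) T := by
  have : IsManifold J 1 M := .of_le (n := ∞) (by simp)
  have : IsManifold I 1 N := .of_le (n := ∞) (by simp)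
  have h := hf.contMDiffOn_tangentMapWithin (m := ∞) le_rfl hS
  exact ContMDiffOn.comp h hV fun x hx ↦ hg hx

theorem smoothAlong_vectorSpace_iff {g : M → E'} {V : M → E'} {S : Set M} :
    SmoothAlong J 𝓘(ℝ, E') g V S ↔
      ContMDiffOn J 𝓘(ℝ, E') ∞ g S ∧ ContMDiffOn J 𝓘(ℝ, E') ∞ V S := by
  refine ⟨fun h ↦ ⟨h.contMDiffOn, ?_⟩, fun ⟨hg, hV⟩ x hx ↦ ?_⟩
  · exact (contMDiff_snd_tangentBundle_modelSpace E' 𝓘(ℝ, E')).comp_contMDiffOn h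
  · refine contMDiffWithinAt_totalSpace.2 ⟨hg x hx, ?_⟩
    convert! hV x hx with y
    simp

end Along

/-! ### Immersions of manifolds -/

section Immersion

variable {E M E' H' N G : Type*}
  [NormedAddCommGroup E] [NormedSpace ℝ E] [TopologicalSpace M] [ChartedSpace E M]
  [NormedAddCommGroup E'] [NormedSpace ℝ E'] [TopologicalSpace H']
  [TopologicalSpace N] [ChartedSpace H' N] {I : ModelWithCorners ℝ E' H'}
  [NormedAddCommGroup G] [NormedSpace ℝ G]

/-- In the charts of the definition an immersion is the inclusion of a factor. Projecting back gives
a local left inverse `k`, and the chain rule makes its derivative a left inverse of the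
differential. -/
theorem injective_mfderiv_of_isImmersion {f : M → N}
    (hf : Manifold.IsImmersion 𝓘(ℝ, E) I ∞ f) (x : M) :
    Function.Injective (differential 𝓘(ℝ, E) I f univ x) := by
  have h := hf.isImmersionAt x
  let p : E' → E := fun w ↦ (h.equiv.symm w).1
  have hp : ContMDiff 𝓘(ℝ, E') 𝓘(ℝ, E) ∞ p :=
    (contDiff_fst.comp h.equiv.symm.contDiff).contMDiff
  let k : N → M := fun y ↦ h.domChart.symm (p (h.codChart.extend I y))
  have hk : ∀ y ∈ h.domChart.source, k (f y) = y := by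
    intro y hy
    have h0 : h.domChart y ∈ (h.domChart.extend 𝓘(ℝ, E)).target := by
      simpa using h.domChart.map_source hy
    have h1 := h.writtenInCharts h0
    simp only [Function.comp_apply] at h1
    have h2 : (h.domChart.extend 𝓘(ℝ, E)).symm (h.domChart y) = y := by
      simpa using h.domChart.left_inv hy
    rw [h2] at h1
    simp only [k, p, h1]
    simpa using h.domChart.left_inv hy
  have hkd : MDifferentiableAt I 𝓘(ℝ, E) k (f x) := by
    have e1 : MDifferentiableAt I 𝓘(ℝ, E') (h.codChart.extend I) (f x) :=
      (h.codChart.contMDiffAt_extend h.codChart_mem_maximalAtlas h.mem_codChart_source).mdifferentiableAt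
        (by simp)
    have e2 : p (h.codChart.extend I (f x)) = h.domChart x := by
      have h0 : h.domChart x ∈ (h.domChart.extend 𝓘(ℝ, E)).target := by
        simpa using h.domChart.map_source h.mem_domChart_source
      have h1 := h.writtenInCharts h0
      simp only [Function.comp_apply] at h1
      have h2 : (h.domChart.extend 𝓘(ℝ, E)).symm (h.domChart x) = x := by
        simpa using h.domChart.left_inv h.mem_domChart_source
      rw [h2] at h1
      simp only [p, h1]
      simp
    have e3 : MDifferentiableAt 𝓘(ℝ, E) 𝓘(ℝ, E) h.domChart.symm
        (p (h.codChart.extend I (f x))) := by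
      rw [e2]
      exact ((contMDiffOn_symm_of_mem_maximalAtlas h.domChart_mem_maximalAtlas).contMDiffAt
        (h.domChart.open_target.mem_nhds
          (h.domChart.map_source h.mem_domChart_source))).mdifferentiableAt (by simp)
    exact e3.comp (f x) ((hp.mdifferentiable (by simp) _).comp (f x) e1)
  have hfd : MDifferentiableAt 𝓘(ℝ, E) I f x :=
    (h.contMDiffAt).mdifferentiableAt (by simp)
  have hcomp : mfderiv 𝓘(ℝ, E) 𝓘(ℝ, E) (k ∘ f) x = ContinuousLinearMap.id ℝ _ := by
    have : k ∘ f =ᶠ[𝓝 x] id := by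
      filter_upwards [h.domChart.open_source.mem_nhds h.mem_domChart_source] with y hy
      exact hk y hy
    rw [this.mfderiv_eq]
    exact mfderiv_id
  rw [mfderiv_comp x hkd hfd] at hcomp
  intro a b hab
  have hab' : mfderiv 𝓘(ℝ, E) I f x a = mfderiv 𝓘(ℝ, E) I f x b := by
    rw [differential, mfderivWithin_univ] at hab
    exact hab
  have h1 : ∀ v, mfderiv I 𝓘(ℝ, E) k (f x) (mfderiv 𝓘(ℝ, E) I f x v) = v :=
    fun v ↦ congrArg (fun L ↦ L v) hcomp
  rw [← h1 a, hab', h1 b]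

variable [FiniteDimensional ℝ E] [FiniteDimensional ℝ E'] [IsManifold 𝓘(ℝ, E) ∞ M]
  [IsManifold I ∞ N]

/-- This reduces to `contDiffWithinAt_of_comp_immersion` in the charts at `g x` and `f (g x)`, after
`S` and `T` are cut down to relatively open parts that these charts see. -/
theorem contMDiffOn_of_comp_immersion {f : M → N} {g : G → M} {h : G → N} {S : Set M} {T : Set G}
    (hS : UniqueMDiffOn 𝓘(ℝ, E) S) (hT : UniqueDiffOn ℝ T)
    (hf : ContMDiffOn 𝓘(ℝ, E) I ∞ f S)
    (hinj : ∀ y ∈ S, Function.Injective (differential 𝓘(ℝ, E) I f S y))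
    (hg : ContinuousOn g T) (hgT : MapsTo g T S)
    (hh : ContMDiffOn 𝓘(ℝ, G) I ∞ h T) (heq : ∀ y ∈ T, f (g y) = h y) :
    ContMDiffOn 𝓘(ℝ, G) 𝓘(ℝ, E) ∞ g T := by
  intro x hx
  set y₀ := g x with hy₀
  have hy₀S : y₀ ∈ S := hgT hx
  obtain ⟨u, hu, hSu⟩ := continuousOn_iff'.1 hf.continuousOn _
    (chartAt H' (f y₀)).open_source
  have hy₀u : y₀ ∈ u := by
    have : y₀ ∈ f ⁻¹' (chartAt H' (f y₀)).source ∩ S := ⟨mem_chart_source H' (f y₀), hy₀S⟩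
    rw [hSu] at this
    exact this.1
  have hfu : ∀ y ∈ S ∩ u, f y ∈ (chartAt H' (f y₀)).source := by
    intro y hy
    have : y ∈ u ∩ S := ⟨hy.2, hy.1⟩
    rw [← hSu] at this
    exact this.1
  obtain ⟨v, hv, hTv⟩ := continuousOn_iff'.1 hg _ ((chartAt E y₀).open_source.inter hu)
  have hgv : ∀ y ∈ T ∩ v, g y ∈ (chartAt E y₀).source ∧ g y ∈ u := by
    intro y hy
    have : y ∈ v ∩ T := ⟨hy.2, hy.1⟩
    rw [← hTv] at this
    exact this.1
  have hxv : x ∈ v := by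
    have : x ∈ g ⁻¹' ((chartAt E y₀).source ∩ u) ∩ T := ⟨⟨mem_chart_source E y₀, hy₀u⟩, hx⟩
    rw [hTv] at this
    exact this.1
  set c := extChartAt 𝓘(ℝ, E) y₀ with hc
  set e := extChartAt I (f y₀) with he
  have hcs : c.source = (chartAt E y₀).source := extChartAt_source _ _
  have hes : e.source = (chartAt H' (f y₀)).source := extChartAt_source _ _
  set S₁ : Set E := c.target ∩ c.symm ⁻¹' (S ∩ u) with hS₁
  have hS₁u : UniqueDiffOn ℝ S₁ := (hS.inter hu).uniqueDiffOn_target_inter y₀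
  have hF : ContDiffOn ℝ ∞ (e ∘ f ∘ c.symm) S₁ := by
    refine ContMDiffOn.contDiffOn ?_
    refine ContMDiffOn.comp (t := (chartAt H' (f y₀)).source) contMDiffOn_extChartAt ?_ ?_
    · refine ContMDiffOn.comp (t := S) hf ?_ fun z hz ↦ hz.2.1
      exact (contMDiffOn_extChartAt_symm y₀).mono inter_subset_left
    · intro z hz
      exact hfu _ hz.2
  have hg₁ : ContinuousOn (c ∘ g) (T ∩ v) :=
    (continuousOn_extChartAt y₀).comp (hg.mono inter_subset_left) fun y hy ↦
      hcs ▸ (hgv y hy).1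
  have hmaps : MapsTo (c ∘ g) (T ∩ v) S₁ := by
    intro y hy
    have h1 : g y ∈ c.source := hcs ▸ (hgv y hy).1
    refine ⟨c.map_source h1, ?_⟩
    simp only [mem_preimage, Function.comp_apply, c.left_inv h1]
    exact ⟨hgT hy.1, (hgv y hy).2⟩
  have hh₁ : ContDiffOn ℝ ∞ (e ∘ h) (T ∩ v) := by
    refine ContMDiffOn.contDiffOn ?_
    refine ContMDiffOn.comp (t := (chartAt H' (f y₀)).source) contMDiffOn_extChartAt
      (hh.mono inter_subset_left) ?_
    intro y hy
    simp only [mem_preimage, ← heq y hy.1]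
    exact hfu _ ⟨hgT hy.1, (hgv y hy).2⟩
  have hinj₁ : Function.Injective (fderivWithin ℝ (e ∘ f ∘ c.symm) S₁ ((c ∘ g) x)) := by
    have h0 := hinj y₀ hy₀S
    have hmd : MDifferentiableWithinAt 𝓘(ℝ, E) I f S y₀ :=
      (hf y₀ hy₀S).mdifferentiableWithinAt (by simp)
    have h1 : differential 𝓘(ℝ, E) I f S y₀ =
        fderivWithin ℝ (e ∘ f ∘ c.symm) (c.symm ⁻¹' S ∩ range 𝓘(ℝ, E)) (c y₀) := by
      simp only [differential, mfderivWithin, hmd]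
      rfl
    -- The set used by `mfderivWithin` and `S₁` have the same germ at `c y₀`, so the derivatives
    -- within them coincide.
    have h2 : (S₁ : Set E) =ᶠ[𝓝 (c y₀)]
        ((c.symm ⁻¹' S ∩ range 𝓘(ℝ, E) : Set E) : Set E) := by
      have t1 : c.target ∈ 𝓝 (c y₀) := extChartAt_target_mem_nhds y₀
      have t2 : c.symm ⁻¹' u ∈ 𝓝 (c y₀) := by
        have := (continuousAt_extChartAt_symm (I := 𝓘(ℝ, E)) y₀).preimage_mem_nhds
          (t := u) (by rw [extChartAt_to_inv]; exact hu.mem_nhds hy₀u)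
        exact this
      filter_upwards [t1, t2] with z hz1 hz2
      apply propext
      change (z ∈ c.target ∧ (c.symm z ∈ S ∧ c.symm z ∈ u)) ↔ (c.symm z ∈ S ∧ z ∈ range _)
      simp only [modelWithCornersSelf_coe, range_id, mem_univ, and_true]
      exact ⟨fun h ↦ h.2.1, fun h ↦ ⟨hz1, h, hz2⟩⟩
    rw [h1] at h0
    rw [Function.comp_apply, ← hy₀, fderivWithin_congr_set h2]
    exact h0
  have key : ContDiffWithinAt ℝ ∞ (c ∘ g) (T ∩ v) x :=
    contDiffWithinAt_of_comp_immersion ⟨hx, hxv⟩ hS₁u (hT.inter hv) hF hg₁ hmaps hh₁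
      (fun y hy ↦ by
        have h1 : g y ∈ c.source := hcs ▸ (hgv y hy).1
        simp only [Function.comp_apply, c.left_inv h1, heq y hy.1]) hinj₁
  have key2 : ContMDiffWithinAt 𝓘(ℝ, G) 𝓘(ℝ, E) ∞ g (T ∩ v) x := by
    have h3 : ContMDiffWithinAt 𝓘(ℝ, G) 𝓘(ℝ, E) ∞ (c.symm ∘ (c ∘ g)) (T ∩ v) x :=
      ContMDiffWithinAt.comp (t := c.target) x
        (contMDiffOn_extChartAt_symm y₀ _ (c.map_source (mem_extChartAt_source y₀)))
        key.contMDiffWithinAt fun y hy ↦ (hmaps hy).1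
    refine h3.congr (fun y hy ↦ ?_) ?_
    · exact (c.left_inv (hcs ▸ (hgv y hy).1)).symm
    · exact (c.left_inv (mem_extChartAt_source y₀)).symm
  exact key2.mono_of_mem_nhdsWithin (inter_mem_nhdsWithin _ (hv.mem_nhds hxv))

end Immersion

/-! ### Frames as linear isomorphisms, and smooth coefficients -/

section Comb

variable {κ F : Type*} [Fintype κ] [NormedAddCommGroup F] [NormedSpace ℝ F]

/-- The linear combinations of a finite family of vectors, as a continuous linear map. -/
noncomputable def comb (u : κ → F) : (κ → ℝ) →L[ℝ] F :=
  ∑ j, (ContinuousLinearMap.proj j : (κ → ℝ) →L[ℝ] ℝ).smulRight (u j)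

@[simp]
theorem comb_apply (u : κ → F) (a : κ → ℝ) : comb u a = ∑ j, a j • u j := by
  simp [comb]

theorem contDiff_comb : ContDiff ℝ ∞ (comb : (κ → F) → (κ → ℝ) →L[ℝ] F) :=
  ContDiff.sum fun j _ ↦ contDiff_const.smulRight (contDiff_apply ℝ F j)

theorem exists_equiv_eq_comb [FiniteDimensional ℝ F] {u : κ → F} (hu : LinearIndependent ℝ u)
    (hκ : Fintype.card κ = Module.finrank ℝ F) :
    ∃ e : (κ → ℝ) ≃L[ℝ] F, (e : (κ → ℝ) →L[ℝ] F) = comb u := by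
  have hinj : Function.Injective (comb u).toLinearMap := by
    rw [← LinearMap.ker_eq_bot, LinearMap.ker_eq_bot']
    intro a ha
    have : ∑ j, a j • u j = 0 := by simpa using ha
    exact funext fun j ↦ Fintype.linearIndependent_iff.1 hu a this j
  let e := LinearEquiv.ofInjectiveOfFinrankEq (comb u).toLinearMap hinj (by simp [hκ])
  refine ⟨e.toContinuousLinearEquiv, ?_⟩
  ext1 a
  rfl

theorem linearIndependent_of_equiv_eq_comb {u : κ → F} {e : (κ → ℝ) ≃L[ℝ] F}
    (he : (e : (κ → ℝ) →L[ℝ] F) = comb u) : LinearIndependent ℝ u := by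
  rw [Fintype.linearIndependent_iff]
  intro a ha
  have : e a = 0 := by
    have := congrArg (fun L : (κ → ℝ) →L[ℝ] F ↦ L a) he
    simpa [ha] using this
  have h0 : a = 0 := by simpa using this
  simp [h0]

end Comb

section Coefficients

variable {κ E H M E' H' N : Type*}
  [NormedAddCommGroup E] [NormedSpace ℝ E] [TopologicalSpace H]
  [TopologicalSpace M] [ChartedSpace H M]
  [NormedAddCommGroup E'] [NormedSpace ℝ E'] [TopologicalSpace H']
  [TopologicalSpace N] [ChartedSpace H' N]
  {J : ModelWithCorners ℝ E H} {I : ModelWithCorners ℝ E' H'} [IsManifold I ∞ N]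

theorem linearIndependent_tangentCoord_iff {p q : N} (hq : q ∈ (chartAt H' p).source)
    {u : κ → E'} :
    LinearIndependent ℝ (fun j ↦ tangentCoord I p q (u j)) ↔ LinearIndependent ℝ u := by
  refine LinearMap.linearIndependent_iff (tangentCoord I p q).toLinearMap ?_
  refine LinearMap.ker_eq_bot.2 fun v w h ↦ ?_
  rw [← tangentCoordSymm_tangentCoord (I := I) hq v, ← tangentCoordSymm_tangentCoord (I := I) hq w]
  exact congrArg _ h

variable [Fintype κ]

theorem contMDiffWithinAt_comb_tangentCoord {f : M → N} {S : Set M} {U : κ → M → E'}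
    (hf : ContMDiffOn J I ∞ f S) (hU : ∀ j, SmoothAlong J I f (U j) S) {x : M} (hx : x ∈ S) :
    ContMDiffWithinAt J 𝓘(ℝ, (κ → ℝ) →L[ℝ] E') ∞
      (fun y ↦ comb fun j ↦ tangentCoord I (f x) (f y) (U j y)) S x := by
  refine (contDiff_comb (κ := κ) (F := E')).contMDiff.contMDiffAt.comp_contMDiffWithinAt
    (f := fun y j ↦ tangentCoord I (f x) (f y) (U j y)) x ?_
  exact contMDiffWithinAt_pi_space.2 fun j ↦
    (contMDiffWithinAt_along_iff hx (hf x hx)).1 (hU j x hx)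

variable [FiniteDimensional ℝ E']

/-- As many vectors as the dimension are independent exactly if `comb` is invertible, and
invertibility is an open condition. -/
theorem eventually_linearIndependent (hκ : Fintype.card κ = Module.finrank ℝ E')
    {f : M → N} {S : Set M} {U : κ → M → E'}
    (hf : ContMDiffOn J I ∞ f S) (hU : ∀ j, SmoothAlong J I f (U j) S) {x : M} (hx : x ∈ S)
    (hind : LinearIndependent ℝ fun j ↦ U j x) :
    ∀ᶠ y in 𝓝[S] x, LinearIndependent ℝ fun j ↦ U j y := by
  obtain ⟨e, he⟩ := exists_equiv_eq_comb
    ((linearIndependent_tangentCoord_iff (I := I) (mem_chart_source H' (f x))).2 hind) hκ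
  have h := (contMDiffWithinAt_comb_tangentCoord hf hU hx).continuousWithinAt.eventually_mem
    (ContinuousLinearEquiv.isOpen.mem_nhds ⟨e, he⟩)
  filter_upwards [h, eventually_mem_chartAt_source (H' := H')
    (hf x hx).continuousWithinAt] with y hy hyc
  obtain ⟨_, hey⟩ := hy
  exact (linearIndependent_tangentCoord_iff hyc).1 (linearIndependent_of_equiv_eq_comb hey)

/-- The coefficients of a smooth vector field with respect to a smooth frame are smooth. -/
theorem exists_smooth_coefficients (hκ : Fintype.card κ = Module.finrank ℝ E')
    {f : M → N} {S : Set M} {U : κ → M → E'} {V : M → E'}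
    (hU : ∀ j, SmoothAlong J I f (U j) S) (hV : SmoothAlong J I f V S)
    (hind : ∀ x ∈ S, LinearIndependent ℝ fun j ↦ U j x) :
    ∃ a : κ → M → ℝ, (∀ j, ContMDiffOn J 𝓘(ℝ, ℝ) ∞ (a j) S) ∧
      ∀ x ∈ S, V x = ∑ j, a j x • U j x := by
  have hf := hV.contMDiffOn
  let a : M → κ → ℝ := fun x ↦ ContinuousLinearMap.inverse (comb fun j ↦ U j x) (V x)
  have key : ∀ x ∈ S, ∑ j, a x j • U j x = V x := by
    intro x hx
    obtain ⟨e, he⟩ := exists_equiv_eq_comb (hind x hx) hκ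
    have : comb (fun j ↦ U j x) (a x) = V x := by
      simp only [a, ← he]
      simp
    simpa using this
  refine ⟨fun j x ↦ a x j, ?_, fun x hx ↦ (key x hx).symm⟩
  suffices h : ContMDiffOn J 𝓘(ℝ, κ → ℝ) ∞ a S from fun j ↦ (contMDiffOn_pi_space.1 h) j
  intro x hx
  obtain ⟨e, he⟩ := exists_equiv_eq_comb
    ((linearIndependent_tangentCoord_iff (I := I) (mem_chart_source H' (f x))).2 (hind x hx)) hκ
  have h1 : ContMDiffWithinAt J 𝓘(ℝ, E' →L[ℝ] (κ → ℝ)) ∞ (fun y ↦ ContinuousLinearMap.inverse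
      (comb fun j ↦ tangentCoord I (f x) (f y) (U j y))) S x := by
    refine ContMDiffAt.comp_contMDiffWithinAt (g := ContinuousLinearMap.inverse)
      (I' := 𝓘(ℝ, (κ → ℝ) →L[ℝ] E')) x ?_ (contMDiffWithinAt_comb_tangentCoord hf hU hx)
    rw [← he]
    exact (contDiffAt_map_inverse e).contMDiffAt
  have h2 := h1.clm_apply ((contMDiffWithinAt_along_iff hx (hf x hx)).1 (hV x hx))
  -- Passing to coordinates at `f x` applies the same isomorphism to the frame and to `V`, so the
  -- coefficients do not change.
  have hev : a =ᶠ[𝓝[S] x] fun y ↦ ContinuousLinearMap.inverse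
      (comb fun j ↦ tangentCoord I (f x) (f y) (U j y)) (tangentCoord I (f x) (f y) (V y)) := by
    filter_upwards [self_mem_nhdsWithin, eventually_mem_chartAt_source (H' := H')
      (hf x hx).continuousWithinAt] with y hy hyc
    obtain ⟨e', he'⟩ := exists_equiv_eq_comb
      ((linearIndependent_tangentCoord_iff (I := I) hyc).2 (hind y hy)) hκ
    have : e' (a y) = tangentCoord I (f x) (f y) (V y) := by
      have h3 := congrArg (fun L : (κ → ℝ) →L[ℝ] E' ↦ L (a y)) he'
      simp only [comb_apply, ContinuousLinearEquiv.coe_coe] at h3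
      rw [h3, ← key y hy, map_sum]
      simp
    rw [← this, ← he']
    simp
  exact h2.congr_of_eventuallyEq hev (hev.self_of_nhdsWithin hx)

end Coefficients

/-! ### Normal frames of embedded surfaces, and their local existence -/

section NormalFrame

variable {M H W : Type*} [TopologicalSpace M] [ChartedSpace (Euc 2) M]
  [TopologicalSpace H] {I : ModelWithCorners ℝ (Euc 5) H}
  [TopologicalSpace W] [ChartedSpace H W]

/-- The partial derivatives of a map on the disk. -/
noncomputable def partialField (I : ModelWithCorners ℝ (Euc 5) H) (f : Euc 2 → W) (k : Fin 2)
    (x : Euc 2) : Euc 5 :=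
  differential 𝓘(ℝ, Euc 2) I f disk x (EuclideanSpace.basisFun (Fin 2) ℝ k)

theorem uniqueDiffOn_disk : UniqueDiffOn ℝ disk :=
  uniqueDiffOn_convex (convex_closedBall 0 1) ⟨0, by
    rw [interior_closedBall _ one_ne_zero]; simp⟩

theorem uniqueMDiffOn_disk : UniqueMDiffOn 𝓘(ℝ, Euc 2) disk :=
  uniqueDiffOn_disk.uniqueMDiffOn

theorem IsEmbeddedDisk.injective_differential {f : Euc 2 → W} (hf : IsEmbeddedDisk I f)
    {x : Euc 2} (hx : x ∈ disk) :
    Function.Injective (differential 𝓘(ℝ, Euc 2) I f disk x) :=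
  hf.immersive x hx

theorem sum_smul_partialField (f : Euc 2 → W) (d : Fin 2 → ℝ) (x : Euc 2) :
    ∑ k, d k • partialField I f k x =
      differential 𝓘(ℝ, Euc 2) I f disk x
        (∑ k, d k • EuclideanSpace.basisFun (Fin 2) ℝ k) := by
  simp [partialField]

theorem differential_eq_sum_partialField (f : Euc 2 → W) (d : Euc 2) (x : Euc 2) :
    differential 𝓘(ℝ, Euc 2) I f disk x d = ∑ k, d k • partialField I f k x := by
  rw [sum_smul_partialField]
  congr 1
  exact ((EuclideanSpace.basisFun (Fin 2) ℝ).sum_repr d).symm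

/-- This translates independence modulo the tangent plane into independence of five vectors in a
space of dimension 5, to which the results on full frames apply. -/
theorem linearIndependent_frame_iff {f : Euc 2 → W} (hf : IsEmbeddedDisk I f)
    {x : Euc 2} (hx : x ∈ disk) (v : Fin 3 → Euc 5) :
    LinearIndependent ℝ (Sum.elim v fun k ↦ partialField I f k x) ↔
      ∀ (c : Fin 3 → ℝ) (d : Euc 2),
        ∑ i, c i • v i = differential 𝓘(ℝ, Euc 2) I f disk x d → c = 0 := by
  rw [Fintype.linearIndependent_iff]
  refine ⟨fun h c d hcd ↦ ?_, fun h g hg ↦ ?_⟩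
  · have := h (Sum.elim c fun k ↦ - d k) (by
      rw [Fintype.sum_sum_type]
      simp only [Sum.elim_inl, Sum.elim_inr, hcd, differential_eq_sum_partialField, neg_smul,
        Finset.sum_neg_distrib]
      simp)
    exact funext fun i ↦ this (Sum.inl i)
  · rw [Fintype.sum_sum_type] at hg
    simp only [Sum.elim_inl, Sum.elim_inr, sum_smul_partialField (I := I) f] at hg
    have hc := h (fun i ↦ g (Sum.inl i)) (-∑ k, g (Sum.inr k) • EuclideanSpace.basisFun (Fin 2) ℝ k)
      (by rw [map_neg]; exact eq_neg_of_add_eq_zero_left hg)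
    have hc' : ∀ i, g (Sum.inl i) = 0 := fun i ↦ congrFun hc i
    simp only [hc', zero_smul, Finset.sum_const_zero, zero_add] at hg
    have h0 : ∑ k, g (Sum.inr k) • EuclideanSpace.basisFun (Fin 2) ℝ k = 0 :=
      hf.injective_differential hx (hg.trans (map_zero _).symm)
    have h1 := Fintype.linearIndependent_iff.1
      (EuclideanSpace.basisFun (Fin 2) ℝ).toBasis.linearIndependent (fun k ↦ g (Sum.inr k))
      (by simpa using h0)
    rintro (i | k)
    exacts [hc' i, h1 k]

theorem finrank_euc_five : Fintype.card (Fin 3 ⊕ Fin 2) = Module.finrank ℝ (Euc 5) := by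
  simp

/-- The vector fields of a normal frame together with the partial derivatives. -/
noncomputable def fullFrame (I : ModelWithCorners ℝ (Euc 5) H) (f : Euc 2 → W)
    (V : Fin 3 → Euc 2 → Euc 5) : Fin 3 ⊕ Fin 2 → Euc 2 → Euc 5 :=
  Sum.elim V (partialField I f)

theorem fullFrame_eq (f : Euc 2 → W) (V : Fin 3 → Euc 2 → Euc 5) (x : Euc 2) :
    (fun j ↦ fullFrame I f V j x) = Sum.elim (V · x) fun k ↦ partialField I f k x := by
  ext1 (i | k) <;> rfl

theorem exists_complement_frame {f : Euc 2 → W} (hf : IsEmbeddedDisk I f) {x : Euc 2}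
    (hx : x ∈ disk) : ∃ w : Fin 3 → Euc 5, ∀ (c : Fin 3 → ℝ) (d : Euc 2),
      ∑ i, c i • w i = differential 𝓘(ℝ, Euc 2) I f disk x d → c = 0 := by
  set P : Submodule ℝ (Euc 5) :=
    LinearMap.range (differential 𝓘(ℝ, Euc 2) I f disk x).toLinearMap with hP
  obtain ⟨Q, hQ⟩ := P.exists_isCompl
  have h1 : Module.finrank ℝ P = 2 := by
    rw [hP, LinearMap.finrank_range_of_inj (hf.injective_differential hx)]; simp
  have h2 : Module.finrank ℝ Q = 3 := by
    have := Submodule.finrank_add_eq_of_isCompl hQ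
    simp [h1] at this
    omega
  let b := Module.finBasisOfFinrankEq ℝ Q h2
  refine ⟨fun i ↦ b i, fun c d h ↦ ?_⟩
  have h3 : ((∑ i, c i • b i : Q) : Euc 5) ∈ P ⊓ Q := by
    refine ⟨?_, Subtype.property _⟩
    rw [hP]
    refine ⟨d, ?_⟩
    rw [Submodule.coe_sum]
    exact h.symm
  rw [hQ.inf_eq_bot, Submodule.mem_bot] at h3
  exact funext (Fintype.linearIndependent_iff.1 b.linearIndependent c (by exact_mod_cast h3))

variable [IsManifold I ∞ W]

/-- `V` represents a framing over `T` of the normal bundle of the surface `f : S → W`: three smooth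
vector fields along `f` on `T ⊆ S` that are linearly independent modulo the tangent planes. -/
structure IsNormalFrame (I : ModelWithCorners ℝ (Euc 5) H) [IsManifold I ∞ W] (f : M → W)
    (S T : Set M) (V : Fin 3 → M → Euc 5) : Prop where
  smooth : ∀ i, SmoothAlong 𝓘(ℝ, Euc 2) I f (V i) T
  eq_zero : ∀ x ∈ T, ∀ (c : Fin 3 → ℝ) (d : Euc 2),
    ∑ i, c i • V i x = differential 𝓘(ℝ, Euc 2) I f S x d → c = 0

theorem IsNormalFrame.mono {f : M → W} {S T T' : Set M} {V : Fin 3 → M → Euc 5}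
    (h : IsNormalFrame I f S T V) (hT : T' ⊆ T) : IsNormalFrame I f S T' V :=
  ⟨fun i ↦ (h.smooth i).mono hT, fun x hx ↦ h.eq_zero x (hT hx)⟩

theorem IsEmbeddedDisk.smoothAlong_partialField {f : Euc 2 → W} (hf : IsEmbeddedDisk I f)
    (k : Fin 2) : SmoothAlong 𝓘(ℝ, Euc 2) I f (partialField I f k) disk :=
  SmoothAlong.map_differential (g := fun x : Euc 2 ↦ x) hf.smooth uniqueMDiffOn_disk
    (smoothAlong_vectorSpace_iff.2 ⟨contMDiffOn_id, contMDiffOn_const⟩) fun _ hx ↦ hx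

/-- The tangential coefficients `b` are kept because a vector field representing a normal section is
determined only up to tangent vectors. -/
theorem IsNormalFrame.exists_coefficients {f : Euc 2 → W} (hf : IsEmbeddedDisk I f)
    {T : Set (Euc 2)} (hT : T ⊆ disk) {V : Fin 3 → Euc 2 → Euc 5}
    (hV : IsNormalFrame I f disk T V) {U : Euc 2 → Euc 5}
    (hU : SmoothAlong 𝓘(ℝ, Euc 2) I f U T) :
    ∃ (a : Fin 3 → Euc 2 → ℝ) (b : Fin 2 → Euc 2 → ℝ),
      (∀ i, ContDiffOn ℝ ∞ (a i) T) ∧ (∀ k, ContDiffOn ℝ ∞ (b k) T) ∧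
      ∀ x ∈ T, U x = ∑ i, a i x • V i x + ∑ k, b k x • partialField I f k x := by
  obtain ⟨a, ha, hUa⟩ := exists_smooth_coefficients finrank_euc_five
    (U := fullFrame I f V) (V := U) (f := f) (S := T) (J := 𝓘(ℝ, Euc 2)) (I := I) (by
      rintro (i | k)
      exacts [hV.smooth i, (hf.smoothAlong_partialField k).mono hT]) hU (by
      intro x hx
      rw [fullFrame_eq, linearIndependent_frame_iff hf (hT hx)]
      exact hV.eq_zero x hx)
  refine ⟨fun i ↦ a (Sum.inl i), fun k ↦ a (Sum.inr k), fun i ↦ (ha _).contDiffOn,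
    fun k ↦ (ha _).contDiffOn, fun x hx ↦ ?_⟩
  rw [hUa x hx, Fintype.sum_sum_type]
  rfl

theorem smoothAlong_tangentCoordSymm {E₁ H₁ M₁ : Type*} [NormedAddCommGroup E₁] [NormedSpace ℝ E₁]
    [TopologicalSpace H₁] [TopologicalSpace M₁] [ChartedSpace H₁ M₁]
    {J : ModelWithCorners ℝ E₁ H₁} {f : M₁ → W} {S : Set M₁}
    (hf : ContMDiffOn J I ∞ f S) (p : W) (hp : ∀ x ∈ S, f x ∈ (chartAt H p).source) (v : Euc 5) :
    SmoothAlong J I f (fun x ↦ tangentCoordSymm I p (f x) v) S := by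
  have : IsManifold I (∞ + 1) W := inferInstanceAs (IsManifold I ∞ W)
  refine (Trivialization.contMDiffOn_iff (IB := I) (n := ∞)
    (e := trivializationAt (Euc 5) (TangentSpace I) p) (fun x hx ↦ ?_)).2
    ⟨hf, ContMDiffOn.congr (contMDiffOn_const (c := v)) fun x hx ↦ ?_⟩
  · exact (Trivialization.mem_source _).2 (hp x hx)
  · exact (congrFun ((trivializationAt (Euc 5) (TangentSpace I) p).coe_linearMapAt_of_mem
      (R := ℝ) (hp x hx)) _).symm.trans (tangentCoord_tangentCoordSymm (hp x hx) v)

/-- Normal frames exist locally. -/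
theorem exists_isNormalFrame_local {f : Euc 2 → W} (hf : IsEmbeddedDisk I f) {x : Euc 2}
    (hx : x ∈ disk) : ∃ u, IsOpen u ∧ x ∈ u ∧ ∃ V, IsNormalFrame I f disk (disk ∩ u) V := by
  obtain ⟨w, hw⟩ := exists_complement_frame hf hx
  -- A complement of the tangent plane at `x` is extended by constant coordinates; it remains a
  -- complement nearby by openness.
  let V : Fin 3 → Euc 2 → Euc 5 := fun i y ↦
    tangentCoordSymm I (f x) (f y) (tangentCoord I (f x) (f x) (w i))
  obtain ⟨u, hu, hxu, hu'⟩ := mem_nhdsWithin.1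
    (eventually_mem_chartAt_source (H' := H) (hf.smooth x hx).continuousWithinAt)
  have hV : ∀ i, SmoothAlong 𝓘(ℝ, Euc 2) I f (V i) (disk ∩ u) := fun i ↦
    smoothAlong_tangentCoordSymm (hf.smooth.mono inter_subset_left) (f x)
      (fun y hy ↦ hu' ⟨hy.2, hy.1⟩) _
  have hVx : ∀ i, V i x = w i := fun i ↦
    tangentCoordSymm_tangentCoord (mem_chart_source H (f x)) (w i)
  have hev := eventually_linearIndependent finrank_euc_five (U := fullFrame I f V)
    (f := f) (S := disk ∩ u) (J := 𝓘(ℝ, Euc 2)) (I := I) (hf.smooth.mono inter_subset_left) (by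
      rintro (i | k)
      exacts [hV i, (hf.smoothAlong_partialField k).mono inter_subset_left]) ⟨hx, hxu⟩ (by
      rw [fullFrame_eq, linearIndependent_frame_iff hf hx]
      simpa only [hVx] using hw)
  obtain ⟨u', hu'o, hxu', hu''⟩ := mem_nhdsWithin.1 hev
  refine ⟨u ∩ u', hu.inter hu'o, ⟨hxu, hxu'⟩, V, fun i ↦ (hV i).mono ?_, fun y hy ↦ ?_⟩
  · rw [← inter_assoc]; exact inter_subset_left
  · have := hu'' ⟨hy.2.2, hy.1, hy.2.1⟩
    simp only [mem_ofPred_eq] at this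
    rw [fullFrame_eq, linearIndependent_frame_iff hf hy.1] at this
    exact this

end NormalFrame

/-! ### Triviality of the normal bundle of a disk -/

section Gluing

variable {H W : Type*} [TopologicalSpace H] {I : ModelWithCorners ℝ (Euc 5) H}
  [TopologicalSpace W] [ChartedSpace H W] [IsManifold I ∞ W]

theorem SmoothAlong.of_locally {E H M E' H' N : Type*}
    [NormedAddCommGroup E] [NormedSpace ℝ E] [TopologicalSpace H]
    [TopologicalSpace M] [ChartedSpace H M]
    [NormedAddCommGroup E'] [NormedSpace ℝ E'] [TopologicalSpace H']
    [TopologicalSpace N] [ChartedSpace H' N]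
    {J : ModelWithCorners ℝ E H} {I : ModelWithCorners ℝ E' H'} [IsManifold I ∞ N]
    {f : M → N} {V : M → E'} {S : Set M}
    (h : ∀ x ∈ S, ∃ u, IsOpen u ∧ x ∈ u ∧ SmoothAlong J I f V (S ∩ u)) :
    SmoothAlong J I f V S :=
  contMDiffOn_of_locally_contMDiffOn h

/-- The smooth map `ℝ → ℝ` that is the identity below `(a + b) / 2` and constant `a` above `b`. -/
noncomputable def clamp (a b s : ℝ) : ℝ :=
  s + Real.smoothTransition ((s - (a + b) / 2) / ((b - a) / 2)) * (a - s)

theorem contDiff_clamp (a b : ℝ) : ContDiff ℝ ∞ (clamp a b) := by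
  unfold clamp
  exact contDiff_id.add ((Real.smoothTransition.contDiff.comp
    ((contDiff_id.sub contDiff_const).div_const _)).mul (contDiff_const.sub contDiff_id))

theorem clamp_of_le {a b s : ℝ} (hab : a < b) (hs : s ≤ (a + b) / 2) : clamp a b s = s := by
  rw [clamp, Real.smoothTransition.zero_of_nonpos, zero_mul, add_zero]
  exact div_nonpos_of_nonpos_of_nonneg (by linarith) (by linarith)

theorem clamp_of_ge {a b s : ℝ} (hab : a < b) (hs : b ≤ s) : clamp a b s = a := by
  rw [clamp, Real.smoothTransition.one_of_one_le]
  · ring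
  · rw [le_div_iff₀ (by linarith)]; linarith

theorem clamp_mem {a b s : ℝ} (hab : a < b) (hs : a ≤ s) :
    a ≤ clamp a b s ∧ clamp a b s ≤ b ∧ clamp a b s ≤ s := by
  rcases le_total b s with h | h
  · rw [clamp_of_ge hab h]; exact ⟨le_rfl, hab.le, hs⟩
  · have h0 := Real.smoothTransition.nonneg ((s - (a + b) / 2) / ((b - a) / 2))
    have h1 := Real.smoothTransition.le_one ((s - (a + b) / 2) / ((b - a) / 2))
    unfold clamp
    refine ⟨?_, ?_, ?_⟩ <;> nlinarith

/-- Replace the `k`-th coordinate of `x` by `c`. -/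
noncomputable def setCoord (k : Fin 2) (x : Euc 2) (c : ℝ) : Euc 2 :=
  x + (c - x k) • EuclideanSpace.single k (1 : ℝ)

theorem setCoord_apply_self (k : Fin 2) (x : Euc 2) (c : ℝ) : setCoord k x c k = c := by
  simp [setCoord]

theorem setCoord_apply_of_ne {k l : Fin 2} (h : l ≠ k) (x : Euc 2) (c : ℝ) :
    setCoord k x c l = x l := by
  simp [setCoord, h]

theorem setCoord_self (k : Fin 2) (x : Euc 2) : setCoord k x (x k) = x := by
  simp [setCoord]

theorem setCoord_mem_disk {k : Fin 2} {x : Euc 2} (hx : x ∈ disk) {c : ℝ}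
    (hc : c ∈ uIcc 0 (x k)) : setCoord k x c ∈ disk := by
  have hc' : |c| ≤ |x k| := by
    have := abs_sub_left_of_mem_uIcc hc
    simpa using this
  rw [mem_closedBall_zero_iff, EuclideanSpace.norm_eq] at hx ⊢
  refine le_trans (Real.sqrt_le_sqrt (Finset.sum_le_sum fun l _ ↦ ?_)) hx
  by_cases h : l = k
  · subst h
    rw [setCoord_apply_self, Real.norm_eq_abs, Real.norm_eq_abs]
    gcongr
  · rw [setCoord_apply_of_ne h]

/-- Normal frames over two overlapping slabs of a set that retracts in a coordinate direction
can be glued. -/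
theorem exists_isNormalFrame_glue {f : Euc 2 → W} (hf : IsEmbeddedDisk I f) {S : Set (Euc 2)}
    (hSd : S ⊆ disk) (k : Fin 2) (hS : ∀ x ∈ S, ∀ c ∈ uIcc 0 (x k), setCoord k x c ∈ S)
    {ε a b : ℝ} (hε : ε = 1 ∨ ε = -1) (ha : 0 ≤ a) (hab : a < b)
    {V U : Fin 3 → Euc 2 → Euc 5}
    (hV : IsNormalFrame I f disk (S ∩ {x | ε * x k ≤ b}) V)
    (hU : IsNormalFrame I f disk (S ∩ {x | a ≤ ε * x k}) U) :
    ∃ F, IsNormalFrame I f disk S F := by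
  have hε2 : ε * ε = 1 := by rcases hε with rfl | rfl <;> norm_num
  have hℓ : Continuous fun x : Euc 2 ↦ ε * x k := by fun_prop
  -- `τ` moves the upper slab into the overlap along the `k`-th coordinate and fixes the lower half
  -- of the overlap; `ε` selects the direction that counts as up.
  let τ : Euc 2 → Euc 2 := fun x ↦ setCoord k x (ε * clamp a b (ε * x k))
  have hτk : ∀ x, ε * τ x k = clamp a b (ε * x k) := fun x ↦ by
    simp only [τ, setCoord_apply_self]
    rw [← mul_assoc, hε2, one_mul]
  have hτ : ContDiff ℝ ∞ τ := by
    have h1 : ContDiff ℝ ∞ fun x : Euc 2 ↦ x k := by fun_prop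
    have h2 : ContDiff ℝ ∞ fun x : Euc 2 ↦ clamp a b (ε * x k) :=
      (contDiff_clamp a b).comp (contDiff_const.mul h1)
    exact contDiff_id.add (((contDiff_const.mul h2).sub h1).smul contDiff_const)
  have hτid : ∀ x, ε * x k ≤ (a + b) / 2 → τ x = x := fun x hx ↦ by
    simp only [τ, clamp_of_le hab hx]
    rw [← mul_assoc, hε2, one_mul, setCoord_self]
  have hτS : ∀ x ∈ S ∩ {x | a ≤ ε * x k}, τ x ∈ S ∩ {x | a ≤ ε * x k ∧ ε * x k ≤ b} := by
    intro x hx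
    have hm := clamp_mem hab hx.2
    refine ⟨hS x hx.1 _ ?_, ?_⟩
    · have hx2 : a ≤ ε * x k := hx.2
      rcases hε with rfl | rfl
      · rw [mem_uIcc]; left; constructor <;> linarith
      · rw [mem_uIcc]; right; constructor <;> linarith
    · simp only [mem_ofPred_eq, hτk]
      exact ⟨hm.1, hm.2.1⟩
  set O : Set (Euc 2) := S ∩ {x | a ≤ ε * x k ∧ ε * x k ≤ b} with hO
  have hOV : O ⊆ S ∩ {x | ε * x k ≤ b} := fun x hx ↦ ⟨hx.1, hx.2.2⟩
  have hOU : O ⊆ S ∩ {x | a ≤ ε * x k} := fun x hx ↦ ⟨hx.1, hx.2.1⟩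
  choose g h hg hh hgh using fun i ↦ IsNormalFrame.exists_coefficients hf
    (inter_subset_left.trans hSd) (hU.mono hOU) ((hV.mono hOV).smooth i)
  -- On the overlap `V` is expressed through `U` by the matrix `g`. Precomposing the coefficients
  -- with `τ` extends them over the whole upper slab, so `X` continues `V` past the overlap.
  let X : Fin 3 → Euc 2 → Euc 5 := fun i x ↦
    ∑ j, g i j (τ x) • U j x + ∑ l, h i l (τ x) • partialField I f l x
  have hX : ∀ i, SmoothAlong 𝓘(ℝ, Euc 2) I f (X i) (S ∩ {x | a ≤ ε * x k}) := by
    intro i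
    have hsm := hf.smooth.mono (inter_subset_left.trans hSd :
      S ∩ {x | a ≤ ε * x k} ⊆ disk)
    refine SmoothAlong.add (SmoothAlong.sum hsm _ fun j _ ↦ SmoothAlong.smul ?_ (hU.smooth j))
      (SmoothAlong.sum hsm _ fun l _ ↦ SmoothAlong.smul ?_
        ((hf.smoothAlong_partialField l).mono (inter_subset_left.trans hSd)))
    · exact ((hg i j).comp hτ.contDiffOn hτS).contMDiffOn
    · exact ((hh i l).comp hτ.contDiffOn hτS).contMDiffOn
  have hXV : ∀ i, ∀ x ∈ S, a ≤ ε * x k → ε * x k ≤ (a + b) / 2 → X i x = V i x := by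
    intro i x hx h1 h2
    simp only [X, hτid x h2]
    exact (hgh i x ⟨hx, h1, by linarith⟩).symm
  classical
  let F : Fin 3 → Euc 2 → Euc 5 := fun i x ↦ if ε * x k < (a + b) / 2 then V i x else X i x
  have hFV : ∀ i x, ε * x k < (a + b) / 2 → F i x = V i x := fun i x hx ↦ if_pos hx
  have hFX : ∀ i, ∀ x ∈ S, a ≤ ε * x k → F i x = X i x := by
    intro i x hx h1
    by_cases h2 : ε * x k < (a + b) / 2
    · rw [hFV i x h2, hXV i x hx h1 h2.le]
    · exact if_neg h2
  refine ⟨F, fun i ↦ SmoothAlong.of_locally fun x hx ↦ ?_, fun x hx c d hcd ↦ ?_⟩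
  · rcases lt_or_ge (ε * x k) ((a + b) / 2) with h1 | h1
    · refine ⟨{x | ε * x k < (a + b) / 2}, isOpen_lt hℓ continuous_const, h1, ?_⟩
      refine ((hV.smooth i).mono fun y hy ↦ ⟨hy.1, ?_⟩).congr (fun _ _ ↦ rfl)
        fun y hy ↦ hFV i y hy.2
      have : ε * y k < (a + b) / 2 := hy.2
      change ε * y k ≤ b
      linarith
    · refine ⟨{x | a < ε * x k}, isOpen_lt continuous_const hℓ, ?_, ?_⟩
      · change a < ε * x k
        linarith
      refine ((hX i).mono fun y hy ↦ ⟨hy.1, ?_⟩).congr (fun _ _ ↦ rfl)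
        fun y hy ↦ hFX i y hy.1 (le_of_lt hy.2)
      exact (show a < ε * y k from hy.2).le
  · rcases lt_or_ge (ε * x k) ((a + b) / 2) with h1 | h1
    · simp only [hFV _ x h1] at hcd
      refine hV.eq_zero x ⟨hx, ?_⟩ c d hcd
      change ε * x k ≤ b
      linarith
    · have hax : a ≤ ε * x k := by linarith
      simp only [hFX _ x hx hax] at hcd
      have e1 : ∑ i, c i • X i x = ∑ j, (∑ i, c i * g i j (τ x)) • U j x +
          ∑ l, (∑ i, c i * h i l (τ x)) • partialField I f l x := by
        simp only [X, smul_add, Finset.smul_sum, Finset.sum_add_distrib, smul_smul,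
          Finset.sum_smul]
        congr 1 <;> exact Finset.sum_comm
      have e2 : ∑ j, (∑ i, c i * g i j (τ x)) • U j x = differential 𝓘(ℝ, Euc 2) I f disk x
          (d - ∑ l, (∑ i, c i * h i l (τ x)) • EuclideanSpace.basisFun (Fin 2) ℝ l) := by
        rw [map_sub, ← sum_smul_partialField, ← hcd, e1]
        abel
      -- Independence of `U` at `x` shows that the matrix `g` at `τ x` kills the row `c`. Then `c`
      -- combines the fields of `V` at `τ x` to a tangent vector, hence `c = 0`.
      have e3 := hU.eq_zero x ⟨hx, hax⟩ _ _ e2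
      have hτO := hτS x ⟨hx, hax⟩
      refine hV.eq_zero (τ x) (hOV hτO) c
        (∑ l, (∑ i, c i * h i l (τ x)) • EuclideanSpace.basisFun (Fin 2) ℝ l) ?_
      rw [← sum_smul_partialField]
      have e4 : ∑ i, c i • V i (τ x) = ∑ j, (∑ i, c i * g i j (τ x)) • U j (τ x) +
          ∑ l, (∑ i, c i * h i l (τ x)) • partialField I f l (τ x) := by
        simp only [fun i ↦ hgh i (τ x) hτO]
        simp only [smul_add, Finset.smul_sum, Finset.sum_add_distrib, smul_smul,
          Finset.sum_smul]
        congr 1 <;> exact Finset.sum_comm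
      rw [e4]
      have e5 : ∀ j, ∑ i, c i * g i j (τ x) = 0 := fun j ↦ congrFun e3 j
      simp only [e5, zero_smul, Finset.sum_const_zero, zero_add]

/-- The frame is extended outwards from a central slab: each induction step glues one slab above (`ε
= 1`) and one below (`ε = -1`), with overlaps of width `δ`. Finitely many steps exhaust `S`, as
coordinates on the disk are bounded by 1. -/
theorem exists_isNormalFrame_of_slabs {f : Euc 2 → W} (hf : IsEmbeddedDisk I f) {S : Set (Euc 2)}
    (hSd : S ⊆ disk) (k : Fin 2) (hS : ∀ x ∈ S, ∀ c ∈ uIcc 0 (x k), setCoord k x c ∈ S)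
    {δ : ℝ} (hδ : 0 < δ)
    (hslab : ∀ c : ℝ, ∃ V, IsNormalFrame I f disk (S ∩ {x | |x k - c| ≤ δ}) V) :
    ∃ V, IsNormalFrame I f disk S V := by
  have key : ∀ n : ℕ, ∃ V, IsNormalFrame I f disk (S ∩ {x | |x k| ≤ (n + 1) * δ}) V := by
    intro n
    induction n with
    | zero => simpa using hslab 0
    | succ n ih =>
      obtain ⟨V, hV⟩ := ih
      have hn : δ ≤ (n + 1) * δ := by nlinarith [(Nat.cast_nonneg n : (0 : ℝ) ≤ n)]
      have hinv : ∀ p q : ℝ, p ≤ 0 → 0 ≤ q → ∀ x ∈ S ∩ {x | p ≤ x k ∧ x k ≤ q},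
          ∀ c ∈ uIcc 0 (x k), setCoord k x c ∈ S ∩ {x | p ≤ x k ∧ x k ≤ q} := by
        intro p q hp hq x hx c hc
        refine ⟨hS x hx.1 c hc, ?_⟩
        have hx2 : p ≤ x k ∧ x k ≤ q := hx.2
        simp only [mem_ofPred_eq, setCoord_apply_self]
        rw [mem_uIcc] at hc
        rcases hc with hc | hc <;> constructor <;> linarith
      obtain ⟨U, hU⟩ := hslab ((n + 1) * δ)
      obtain ⟨U', hU'⟩ := hslab (-((n + 1) * δ))
      obtain ⟨V₁, hV₁⟩ : ∃ F, IsNormalFrame I f disk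
          (S ∩ {x | -((n + 1) * δ) ≤ x k ∧ x k ≤ (n + 1) * δ + δ}) F := by
        refine exists_isNormalFrame_glue hf (inter_subset_left.trans hSd) k
          (hinv _ _ (by linarith) (by linarith)) (a := (n + 1) * δ - δ) (b := (n + 1) * δ)
          (Or.inl rfl) (by linarith) (by linarith)
          (hV.mono ?_) (hU.mono ?_)
        · rintro x ⟨⟨hx, h1, h2⟩, h3⟩
          simp only [mem_ofPred_eq, one_mul] at h3
          exact ⟨hx, abs_le.2 ⟨h1, h3⟩⟩
        · rintro x ⟨⟨hx, h1, h2⟩, h3⟩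
          simp only [mem_ofPred_eq, one_mul] at h3
          refine ⟨hx, ?_⟩
          change |x k - (n + 1) * δ| ≤ δ
          rw [abs_le]
          constructor <;> linarith
      obtain ⟨V₂, hV₂⟩ : ∃ F, IsNormalFrame I f disk
          (S ∩ {x | -((n + 1) * δ + δ) ≤ x k ∧ x k ≤ (n + 1) * δ + δ}) F := by
        refine exists_isNormalFrame_glue hf (inter_subset_left.trans hSd) k
          (hinv _ _ (by linarith) (by linarith)) (a := (n + 1) * δ - δ) (b := (n + 1) * δ)
          (Or.inr rfl) (by linarith) (by linarith)
          (hV₁.mono ?_) (hU'.mono ?_)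
        · rintro x ⟨⟨hx, h1, h2⟩, h3⟩
          simp only [mem_ofPred_eq] at h3
          exact ⟨hx, by linarith, h2⟩
        · rintro x ⟨⟨hx, h1, h2⟩, h3⟩
          simp only [mem_ofPred_eq] at h3
          refine ⟨hx, ?_⟩
          change |x k - -((n + 1) * δ)| ≤ δ
          rw [abs_le]
          constructor <;> linarith
      refine ⟨V₂, hV₂.mono ?_⟩
      rintro x ⟨hx, h1⟩
      simp only [mem_ofPred_eq, Nat.cast_add, Nat.cast_one] at h1
      have := abs_le.1 h1
      exact ⟨hx, by linarith, by linarith⟩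
  obtain ⟨n, hn⟩ := exists_nat_gt (1 / δ)
  obtain ⟨V, hV⟩ := key n
  refine ⟨V, hV.mono fun x hx ↦ ⟨hx, ?_⟩⟩
  have h1 : ‖x k‖ ≤ 1 := (PiLp.norm_apply_le x k).trans (by simpa using hSd hx)
  rw [div_lt_iff₀ hδ] at hn
  rw [Real.norm_eq_abs] at h1
  change |x k| ≤ (n + 1) * δ
  linarith

/-- The normal bundle of an embedded disk is trivial. -/
theorem IsEmbeddedDisk.exists_isNormalFrame {f : Euc 2 → W} (hf : IsEmbeddedDisk I f) :
    ∃ V, IsNormalFrame I f disk disk V := by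
  choose! u hu hxu hV using fun x (hx : x ∈ disk) ↦ exists_isNormalFrame_local hf hx
  obtain ⟨δ, hδ, hball⟩ := lebesgue_number_lemma_of_metric (isCompact_closedBall (0 : Euc 2) 1)
    (c := fun x : disk ↦ u x) (fun x ↦ hu x x.2)
    (fun x hx ↦ mem_iUnion.2 ⟨⟨x, hx⟩, hxu x hx⟩)
  -- A slab in each coordinate, of half-width `δ / 4`, cuts out a square of side `δ / 2`. Its
  -- diameter is less than the Lebesgue number `δ`, so the square lies in a set on which a local
  -- frame exists.
  have hδ' : 0 < δ / 4 := by linarith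
  refine exists_isNormalFrame_of_slabs hf Subset.rfl 0
    (fun x hx c hc ↦ setCoord_mem_disk hx hc) hδ' fun c₀ ↦ ?_
  refine exists_isNormalFrame_of_slabs hf inter_subset_left 1
    (fun x hx c hc ↦ ⟨setCoord_mem_disk hx.1 hc, ?_⟩) hδ' fun c₁ ↦ ?_
  · simp only [mem_ofPred_eq]
    rw [setCoord_apply_of_ne (by decide)]
    exact hx.2
  · rcases ((disk ∩ {x | |x 0 - c₀| ≤ δ / 4}) ∩ {x | |x 1 - c₁| ≤ δ / 4}).eq_empty_or_nonempty
      with h | ⟨x, ⟨hx, hx0⟩, hx1⟩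
    · rw [h]
      exact ⟨0, fun i x hx ↦ hx.elim, fun x hx ↦ hx.elim⟩
    · obtain ⟨y, hy⟩ := hball x hx
      obtain ⟨V, hV⟩ := hV y y.2
      refine ⟨V, hV.mono ?_⟩
      rintro w ⟨⟨hw, hw0⟩, hw1⟩
      refine ⟨hw, hy ?_⟩
      simp only [mem_ofPred_eq, abs_le] at hx0 hx1 hw0 hw1
      rw [mem_ball, EuclideanSpace.dist_eq, Real.sqrt_lt' hδ, Fin.sum_univ_two, Real.dist_eq,
        Real.dist_eq, sq_abs, sq_abs]
      have a0 : (w 0 - x 0) ^ 2 ≤ (δ / 2) ^ 2 := sq_le_sq' (by linarith) (by linarith)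
      have a1 : (w 1 - x 1) ^ 2 ≤ (δ / 2) ^ 2 := sq_le_sq' (by linarith) (by linarith)
      nlinarith

end Gluing

/-! ### Chain rules, and compact surfaces with lifts into them -/

section Differential

variable {E H M E' H' N E'' H'' M' : Type*}
  [NormedAddCommGroup E] [NormedSpace ℝ E] [TopologicalSpace H]
  [TopologicalSpace M] [ChartedSpace H M]
  [NormedAddCommGroup E'] [NormedSpace ℝ E'] [TopologicalSpace H']
  [TopologicalSpace N] [ChartedSpace H' N]
  [NormedAddCommGroup E''] [NormedSpace ℝ E''] [TopologicalSpace H'']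
  [TopologicalSpace M'] [ChartedSpace H'' M']
  {J : ModelWithCorners ℝ E H} {I : ModelWithCorners ℝ E' H'} {J' : ModelWithCorners ℝ E'' H''}

theorem differential_of_eq_comp {f : M → N} {g : M' → M} {h : M' → N} {S : Set M} {T : Set M'}
    {x : M'} (hf : ContMDiffOn J I ∞ f S) (hg : ContMDiffOn J' J ∞ g T) (hT : UniqueMDiffOn J' T)
    (hgT : MapsTo g T S) (heq : ∀ y ∈ T, h y = f (g y)) (hx : x ∈ T) :
    differential J' I h T x = (differential J I f S (g x)).comp (differential J' J g T x) := by
  have h1 := mfderivWithin_comp x ((hf _ (hgT hx)).mdifferentiableWithinAt (by simp))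
    ((hg x hx).mdifferentiableWithinAt (by simp)) hgT (hT x hx)
  have h2 : differential J' I h T x = differential J' I (f ∘ g) T x :=
    mfderivWithin_congr (fun y hy ↦ heq y hy) (heq x hx)
  rw [h2]
  exact h1

theorem differential_inter {f : M → N} {S u : Set M} {x : M} (hu : IsOpen u) (hx : x ∈ u) :
    differential J I f (S ∩ u) x = differential J I f S x :=
  mfderivWithin_inter (hu.mem_nhds hx)

theorem differential_eq_fderivWithin {f : E → E'} {S : Set E} {x : E} :
    differential 𝓘(ℝ, E) 𝓘(ℝ, E') f S x = fderivWithin ℝ f S x :=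
  mfderivWithin_eq_fderivWithin

end Differential

section Surface

variable {M H W : Type*} [TopologicalSpace M] [ChartedSpace (Euc 2) M]
  [TopologicalSpace H] {I : ModelWithCorners ℝ (Euc 5) H}
  [TopologicalSpace W] [ChartedSpace H W]

/-- A compact embedded surface in `W`, given as a map on a subset `S` of a manifold. -/
structure IsSurface (I : ModelWithCorners ℝ (Euc 5) H) (f : M → W) (S : Set M) : Prop where
  isCompact : IsCompact S
  unique : UniqueMDiffOn 𝓘(ℝ, Euc 2) S
  smooth : ContMDiffOn 𝓘(ℝ, Euc 2) I ∞ f S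
  injOn : InjOn f S
  immersive : ∀ x ∈ S, Function.Injective (differential 𝓘(ℝ, Euc 2) I f S x)

theorem IsEmbeddedDisk.isSurface {f : Euc 2 → W} (hf : IsEmbeddedDisk I f) :
    IsSurface I f disk :=
  ⟨isCompact_closedBall 0 1, uniqueMDiffOn_disk, hf.smooth, hf.injOn, hf.immersive⟩

/-- This puts the sphere on the same footing as the disk, so that both ends of the tube are treated
by the same lemmas. -/
theorem isSurface_of_isSmoothEmbedding {R : Sph → W}
    (hR : Manifold.IsSmoothEmbedding (𝓡 2) I ∞ R) : IsSurface I R univ :=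
  ⟨isCompact_univ, uniqueMDiffOn_univ, hR.contMDiff.contMDiffOn, hR.isEmbedding.injective.injOn,
    fun x _ ↦ injective_mfderiv_of_isImmersion hR.isImmersion x⟩

variable [IsManifold 𝓘(ℝ, Euc 2) ∞ M] [IsManifold I ∞ W] [T2Space W]

/-- A smooth map into an embedded surface is smooth as a map to the parameter domain. -/
theorem IsSurface.contMDiffOn_lift {G : Type*} [NormedAddCommGroup G] [NormedSpace ℝ G]
    {f : M → W} {S : Set M} (hf : IsSurface I f S) {g : G → M} {h : G → W} {T : Set G}
    (hT : UniqueDiffOn ℝ T) (hgT : MapsTo g T S) (hh : ContMDiffOn 𝓘(ℝ, G) I ∞ h T)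
    (heq : ∀ y ∈ T, f (g y) = h y) : ContMDiffOn 𝓘(ℝ, G) 𝓘(ℝ, Euc 2) ∞ g T :=
  contMDiffOn_of_comp_immersion hf.unique hT hf.smooth hf.immersive
    (continuousOn_of_comp_injOn hf.isCompact hf.smooth.continuousOn hf.injOn hgT
      (hh.continuousOn.congr heq)) hgT hh heq

end Surface

/-! ### Normal frames in the coordinates of the model box -/

section Box

variable {H W : Type*} [TopologicalSpace H] {I : ModelWithCorners ℝ (Euc 5) H}
  [TopologicalSpace W] [ChartedSpace H W]

/-- `Ψ` is a diffeomorphism from the model box onto an open subset of `W`. -/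
structure IsBoxChart (I : ModelWithCorners ℝ (Euc 5) H) (Ψ : OpenPartialHomeomorph Model W) :
    Prop where
  source_eq : Ψ.source = modelBox
  smooth : ContMDiffOn 𝓘(ℝ, Model) I ∞ Ψ Ψ.source
  smooth_symm : ContMDiffOn I 𝓘(ℝ, Model) ∞ Ψ.symm Ψ.target

/-- The differential of a box chart. -/
noncomputable def boxDiff (I : ModelWithCorners ℝ (Euc 5) H) (Ψ : OpenPartialHomeomorph Model W)
    (q : Model) : Model →L[ℝ] Euc 5 :=
  differential 𝓘(ℝ, Model) I Ψ Ψ.source q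

/-- The differential of the inverse of a box chart. -/
noncomputable def boxDiffSymm (I : ModelWithCorners ℝ (Euc 5) H)
    (Ψ : OpenPartialHomeomorph Model W) (p : W) : Euc 5 →L[ℝ] Model :=
  differential I 𝓘(ℝ, Model) Ψ.symm Ψ.target p

variable {Ψ : OpenPartialHomeomorph Model W}

theorem IsBoxChart.boxDiffSymm_boxDiff (hΨ : IsBoxChart I Ψ) {q : Model} (hq : q ∈ Ψ.source)
    (v : Model) : boxDiffSymm I Ψ (Ψ q) (boxDiff I Ψ q v) = v := by
  have h := differential_of_eq_comp (h := id) hΨ.smooth_symm hΨ.smooth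
    Ψ.open_source.uniqueMDiffOn Ψ.mapsTo (fun y hy ↦ (Ψ.left_inv hy).symm) hq
  have h2 : differential 𝓘(ℝ, Model) 𝓘(ℝ, Model) id Ψ.source q = ContinuousLinearMap.id ℝ Model :=
    mfderivWithin_id (Ψ.open_source.uniqueMDiffOn q hq)
  rw [h2] at h
  exact (congrArg (fun L : Model →L[ℝ] Model ↦ L v) h).symm

theorem IsBoxChart.boxDiff_boxDiffSymm (hΨ : IsBoxChart I Ψ) {q : Model} (hq : q ∈ Ψ.source)
    (w : Euc 5) : boxDiff I Ψ q (boxDiffSymm I Ψ (Ψ q) w) = w := by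
  have hinj : Function.Injective (boxDiff I Ψ q).toLinearMap := fun v v' hv ↦ by
    rw [← hΨ.boxDiffSymm_boxDiff hq v, ← hΨ.boxDiffSymm_boxDiff hq v']
    exact congrArg _ hv
  -- Both sides have dimension 5.
  have hsurj := (LinearMap.injective_iff_surjective_of_finrank_eq_finrank (by simp)).1 hinj
  obtain ⟨v, rfl⟩ := hsurj w
  exact congrArg _ (hΨ.boxDiffSymm_boxDiff hq v)

theorem mem_modelBox {x : Euc 2} (hx : x ∈ ball (0 : Euc 2) 2) {z : ℝ} (h1 : -1 < z) (h2 : z < 2) :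
    ((x, z, 0) : Model) ∈ modelBox := by
  refine ⟨by simpa using hx, h1, h2, by simp⟩

variable {M : Type*} [TopologicalSpace M] [ChartedSpace (Euc 2) M] [IsManifold I ∞ W]

/-- A constant change of frame is what makes the frame of the sphere match that of the disk on the
axis of the tube. -/
theorem IsNormalFrame.transform {f : M → W} {S T : Set M} {V : Fin 3 → M → Euc 5}
    (hV : IsNormalFrame I f S T V) {C : Fin 3 → Fin 3 → ℝ}
    (hC : ∀ c : Fin 3 → ℝ, (∀ j, ∑ i, c i * C i j = 0) → c = 0) :
    IsNormalFrame I f S T fun i x ↦ ∑ j, C i j • V j x := by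
  refine ⟨fun i ↦ SmoothAlong.sum (hV.smooth 0).contMDiffOn _ fun j _ ↦
    SmoothAlong.smul contMDiffOn_const (hV.smooth j), fun x hx c d h ↦ hC c fun j ↦ ?_⟩
  have h1 : ∑ j, (∑ i, c i * C i j) • V j x = differential 𝓘(ℝ, Euc 2) I f S x d := by
    rw [← h]
    simp only [Finset.smul_sum, Finset.sum_smul, smul_smul]
    exact Finset.sum_comm
  exact congrFun (hV.eq_zero x hx _ d h1) j

/-- The fields of a normal frame of a surface that is a horizontal plane in the box, in box
coordinates. -/
theorem IsNormalFrame.exists_boxCoord [IsManifold 𝓘(ℝ, Euc 2) ∞ M] [T2Space W]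
    (hΨ : IsBoxChart I Ψ) {f : M → W} {S : Set M}
    (hf : IsSurface I f S) {V : Fin 3 → M → Euc 5} (hV : IsNormalFrame I f S S V) {z : ℝ}
    (hz1 : -1 < z) (hz2 : z < 2) (hsheet : ∀ x ∈ ball (0 : Euc 2) 2, Ψ (x, z, 0) ∈ f '' S) :
    ∃ a : Fin 3 → Euc 2 → Model, (∀ i, ContDiffOn ℝ ∞ (a i) (ball 0 2)) ∧
      (∀ x ∈ ball (0 : Euc 2) 2, ∀ y ∈ S, f y = Ψ (x, z, 0) →
        ∀ i, V i y = boxDiff I Ψ (x, z, 0) (a i x)) ∧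
      ∀ x ∈ ball (0 : Euc 2) 2, ∀ c : Fin 3 → ℝ, ∑ i, c i • (a i x).2 = 0 → c = 0 := by
  have : Nonempty M := ⟨(hsheet 0 (by simp)).choose⟩
  -- `k` expresses the horizontal sheet in the parameter domain of the surface; it is smooth by the
  -- lifting lemma.
  choose! k hkS hk using hsheet
  have hbox : ∀ x ∈ ball (0 : Euc 2) 2, ((x, z, 0) : Model) ∈ Ψ.source := fun x hx ↦
    hΨ.source_eq ▸ mem_modelBox hx hz1 hz2
  let j : Euc 2 → Model := fun x ↦ (x, z, 0)
  have hj : ContDiff ℝ ∞ j := contDiff_id.prodMk contDiff_const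
  have hΨj : ContMDiffOn 𝓘(ℝ, Euc 2) I ∞ (fun x ↦ Ψ (j x)) (ball 0 2) :=
    hΨ.smooth.comp hj.contMDiff.contMDiffOn hbox
  have hksm : ContMDiffOn 𝓘(ℝ, Euc 2) 𝓘(ℝ, Euc 2) ∞ k (ball 0 2) :=
    hf.contMDiffOn_lift isOpen_ball.uniqueDiffOn hkS hΨj hk
  refine ⟨fun i x ↦ boxDiffSymm I Ψ (f (k x)) (V i (k x)), fun i ↦ ?_, ?_, ?_⟩
  · have h1 : SmoothAlong 𝓘(ℝ, Euc 2) I (fun x ↦ f (k x)) (fun x ↦ V i (k x)) (ball 0 2) :=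
      (hV.smooth i).comp hksm hkS
    have h2 := SmoothAlong.map_differential hΨ.smooth_symm Ψ.open_target.uniqueMDiffOn h1
      (fun x hx ↦ by rw [hk x hx]; exact Ψ.map_source (hbox x hx))
    exact (smoothAlong_vectorSpace_iff.1 h2).2.contDiffOn
  · intro x hx y hy hxy i
    have : y = k x := hf.injOn hy (hkS x hx) (hxy.trans (hk x hx).symm)
    subst this
    beta_reduce
    rw [hxy]
    exact (hΨ.boxDiff_boxDiffSymm (hbox x hx) _).symm
  · intro x hx c hc
    have hd1 := differential_of_eq_comp (x := x) (h := fun x ↦ Ψ (j x)) hΨ.smooth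
      hj.contMDiff.contMDiffOn isOpen_ball.uniqueMDiffOn hbox (fun _ _ ↦ rfl) hx
    have hd2 := differential_of_eq_comp (x := x) (h := fun x ↦ Ψ (j x)) hf.smooth
      hksm isOpen_ball.uniqueMDiffOn hkS (fun y hy ↦ (hk y hy).symm) hx
    -- If the last two components of `v` vanish, then `v` is tangent to the horizontal sheet, and
    -- its image is tangent to the surface.
    set v : Model := ∑ i, c i • boxDiffSymm I Ψ (f (k x)) (V i (k x)) with hv
    have hv2 : v.2 = 0 := by rw [hv, Prod.snd_sum]; exact hc
    have hj' : differential 𝓘(ℝ, Euc 2) 𝓘(ℝ, Model) j (ball 0 2) x v.1 = v := by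
      rw [differential_eq_fderivWithin]
      have : HasFDerivWithinAt j ((ContinuousLinearMap.id ℝ (Euc 2)).prod 0) (ball 0 2) x :=
        (hasFDerivWithinAt_id x _).prodMk (hasFDerivWithinAt_const _ _ _)
      rw [this.fderivWithin (isOpen_ball.uniqueDiffOn x hx)]
      exact Prod.ext rfl hv2.symm
    refine hV.eq_zero (k x) (hkS x hx) c
      (differential 𝓘(ℝ, Euc 2) 𝓘(ℝ, Euc 2) k (ball 0 2) x v.1) ?_
    have h3 : boxDiff I Ψ (j x) v = ∑ i, c i • V i (k x) := by
      rw [hv, map_sum]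
      refine Finset.sum_congr rfl fun i _ ↦ ?_
      rw [map_smul, hk x hx, hΨ.boxDiff_boxDiffSymm (hbox x hx)]
    rw [← h3]
    have h4 := congrArg (fun L : Euc 2 →L[ℝ] Euc 5 ↦ L v.1) (hd1.symm.trans hd2)
    simp only [ContinuousLinearMap.comp_apply] at h4
    rw [hj'] at h4
    exact h4

end Box

/-! ### The tube and its tangent vectors -/

section Profile

variable {r z : ℝ → ℝ}

theorem IsTubeProfile.r_pos (h : IsTubeProfile r z) (t : ℝ) : 0 < r t := by
  rcases le_or_gt t (-1) with h1 | h1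
  · rw [(h.incoming t h1).1]; linarith
  · rcases lt_or_ge t 1 with h2 | h2
    · exact (h.middle t h1 h2).1
    · rw [(h.outgoing t h2).1]; linarith

theorem IsTubeProfile.deriv_of_lt (h : IsTubeProfile r z) {t : ℝ} (ht : t < -1) :
    deriv r t = -1 ∧ deriv z t = 0 := by
  have h1 : r =ᶠ[𝓝 t] fun s ↦ -s := by
    filter_upwards [Iio_mem_nhds ht] with s hs using (h.incoming s hs.le).1
  have h2 : z =ᶠ[𝓝 t] fun _ ↦ 0 := by
    filter_upwards [Iio_mem_nhds ht] with s hs using (h.incoming s hs.le).2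
  rw [h1.deriv_eq, h2.deriv_eq]
  simp

theorem IsTubeProfile.deriv_of_gt (h : IsTubeProfile r z) {t : ℝ} (ht : 1 < t) :
    deriv r t = 1 ∧ deriv z t = 0 := by
  have h1 : r =ᶠ[𝓝 t] fun s ↦ s := by
    filter_upwards [Ioi_mem_nhds ht] with s hs using (h.outgoing s hs.le).1
  have h2 : z =ᶠ[𝓝 t] fun _ ↦ 1 := by
    filter_upwards [Ioi_mem_nhds ht] with s hs using (h.outgoing s hs.le).2
  rw [h1.deriv_eq, h2.deriv_eq]
  simp

theorem IsTubeProfile.r_le_one (h : IsTubeProfile r z) {t : ℝ} (h1 : -1 ≤ t) (h2 : t ≤ 1) :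
    r t ≤ 1 := by
  rcases h1.eq_or_lt with rfl | h1
  · rw [(h.incoming _ le_rfl).1]; norm_num
  rcases h2.eq_or_lt with rfl | h2
  · rw [(h.outgoing _ le_rfl).1]
  exact (h.middle t h1 h2).2.1.le

/-- The map `q` runs in the (prolonged) tube with parameter `t`. -/
structure IsTubeMap (r z : ℝ → ℝ) (T : Set (Euc 2)) (q : Euc 2 → Model) (t : Euc 2 → ℝ) :
    Prop where
  smooth : ContDiffOn ℝ ∞ q T
  smooth_param : ContDiffOn ℝ ∞ t T
  param_mem : ∀ x ∈ T, t x ∈ Ioo (-2 : ℝ) 2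
  norm_eq : ∀ x ∈ T, ‖(q x).1‖ = r (t x)
  height_eq : ∀ x ∈ T, (q x).2.1 = z (t x)
  snd_eq : ∀ x ∈ T, (q x).2.2 = 0

/-- The profile parameter is a lift through the curve `(r, z)`, which is injective and immersive.
Continuity of the lift comes from compactness of `[-2, 2]`, and the norm is smooth because the tube
avoids the axis. -/
theorem IsTubeProfile.exists_isTubeMap (h : IsTubeProfile r z) {T : Set (Euc 2)}
    (hT : UniqueDiffOn ℝ T) {q : Euc 2 → Model} (hq : ContDiffOn ℝ ∞ q T)
    (hqT : ∀ x ∈ T, ∃ t ∈ Ioo (-2 : ℝ) 2, ‖(q x).1‖ = r t ∧ (q x).2.1 = z t ∧ (q x).2.2 = 0) :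
    ∃ t, IsTubeMap r z T q t := by
  choose! t ht hr hz hw using hqT
  refine ⟨t, hq, ?_, ht, hr, hz, hw⟩
  have hne : ∀ x ∈ T, (q x).1 ≠ 0 := fun x hx h0 ↦ by
    have := h.r_pos (t x)
    rw [← hr x hx, h0, norm_zero] at this
    exact lt_irrefl _ this
  have hcurve : ContDiff ℝ ∞ fun t ↦ (r t, z t) := h.smooth_r.prodMk h.smooth_z
  have hrhs : ContDiffOn ℝ ∞ (fun x ↦ (‖(q x).1‖, (q x).2.1)) T :=
    (hq.fst.norm ℝ hne).prodMk hq.snd.fst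
  have heq : ∀ x ∈ T, (r (t x), z (t x)) = (‖(q x).1‖, (q x).2.1) := fun x hx ↦ by
    rw [hr x hx, hz x hx]
  have hcont : ContinuousOn t T :=
    continuousOn_of_comp_injOn (f := fun t ↦ (r t, z t)) (isCompact_Icc (a := (-2 : ℝ)) (b := 2))
      hcurve.continuous.continuousOn h.injective.injOn (fun x hx ↦ Ioo_subset_Icc_self (ht x hx))
      (hrhs.continuousOn.congr heq)
  intro x hx
  refine contDiffWithinAt_of_comp_immersion (f := fun t ↦ (r t, z t)) hx uniqueDiffOn_univ hT
    hcurve.contDiffOn hcont (mapsTo_univ _ _) hrhs heq ?_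
  have hd : HasDerivAt (fun t ↦ (r t, z t)) (deriv r (t x), deriv z (t x)) (t x) :=
    ((h.smooth_r.differentiable (by simp)) _).hasDerivAt.prodMk
      ((h.smooth_z.differentiable (by simp)) _).hasDerivAt
  rw [fderivWithin_univ, hd.hasFDerivAt.fderiv]
  intro a b hab
  have h1 : a * deriv r (t x) = b * deriv r (t x) ∧ a * deriv z (t x) = b * deriv z (t x) := by
    simpa using hab
  rcases h.regular (t x) with h0 | h0
  · exact mul_right_cancel₀ h0 h1.1
  · exact mul_right_cancel₀ h0 h1.2

/-- The unit vector in the direction of `x`. -/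
noncomputable def direction (x : Euc 2) : Euc 2 := ‖x‖⁻¹ • x

theorem norm_direction {x : Euc 2} (hx : x ≠ 0) : ‖direction x‖ = 1 := by
  rw [direction, norm_smul, norm_inv, norm_norm, inv_mul_cancel₀ (norm_ne_zero_iff.2 hx)]

theorem norm_smul_direction {x : Euc 2} (hx : x ≠ 0) : ‖x‖ • direction x = x := by
  rw [direction, smul_smul, mul_inv_cancel₀ (norm_ne_zero_iff.2 hx), one_smul]

/-- The vectors tangent to the tube. -/
theorem IsTubeMap.fderivWithin_apply (h : IsTubeProfile r z) {T : Set (Euc 2)}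
    (hT : UniqueDiffOn ℝ T) {q : Euc 2 → Model} {t : Euc 2 → ℝ} (hq : IsTubeMap r z T q t)
    {x : Euc 2} (hx : x ∈ T) (d : Euc 2) :
    (fderivWithin ℝ q T x d).2.2 = 0 ∧ deriv r (t x) * (fderivWithin ℝ q T x d).2.1 =
      deriv z (t x) * inner ℝ (direction (q x).1) (fderivWithin ℝ q T x d).1 := by
  have hqd : HasFDerivWithinAt q (fderivWithin ℝ q T x) T x :=
    (hq.smooth.differentiableOn (by simp) x hx).hasFDerivWithinAt
  have htd : HasFDerivWithinAt t (fderivWithin ℝ t T x) T x :=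
    (hq.smooth_param.differentiableOn (by simp) x hx).hasFDerivWithinAt
  have hU := hT x hx
  have hrt : HasFDerivWithinAt (fun y ↦ r (t y)) (deriv r (t x) • fderivWithin ℝ t T x) T x :=
    ((h.smooth_r.differentiable (by simp)) _).hasDerivAt.comp_hasFDerivWithinAt x htd
  have hzt : HasFDerivWithinAt (fun y ↦ z (t y)) (deriv z (t x) • fderivWithin ℝ t T x) T x :=
    ((h.smooth_z.differentiable (by simp)) _).hasDerivAt.comp_hasFDerivWithinAt x htd
  have e1 : (fderivWithin ℝ q T x d).2.2 = 0 := by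
    have h1 : HasFDerivWithinAt (fun y ↦ (q y).2.2) (0 : Euc 2 →L[ℝ] Euc 2) T x :=
      (hasFDerivWithinAt_const (0 : Euc 2) x T).congr hq.snd_eq (hq.snd_eq x hx)
    exact congrArg (fun L : Euc 2 →L[ℝ] Euc 2 ↦ L d) (hU.eq hqd.snd.snd h1)
  have e2 : (fderivWithin ℝ q T x d).2.1 = deriv z (t x) * fderivWithin ℝ t T x d :=
    congrArg (fun L : Euc 2 →L[ℝ] ℝ ↦ L d)
      (hU.eq hqd.snd.fst (hzt.congr hq.height_eq (hq.height_eq x hx)))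
  have hne : (q x).1 ≠ 0 := fun h0 ↦ by
    have := h.r_pos (t x)
    rw [← hq.norm_eq x hx, h0, norm_zero] at this
    exact lt_irrefl _ this
  have e3 : inner ℝ (direction (q x).1) (fderivWithin ℝ q T x d).1 =
      deriv r (t x) * fderivWithin ℝ t T x d := by
    -- The radial derivative is found by differentiating `‖q‖² = r(t)²` and dividing by the positive
    -- radius.
    have h1 := hqd.fst.norm_sq
    have h2 : HasFDerivWithinAt (fun y ↦ ‖(q y).1‖ ^ 2) _ T x :=
      (hrt.pow 2).congr (fun y hy ↦ by rw [hq.norm_eq y hy]) (by rw [hq.norm_eq x hx])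
    have h3 := congrArg (fun L : Euc 2 →L[ℝ] ℝ ↦ L d) (hU.eq h1 h2)
    rw [direction, real_inner_smul_left, hq.norm_eq x hx]
    have hr := (h.r_pos (t x)).ne'
    rw [inv_mul_eq_iff_eq_mul₀ hr]
    simp at h3
    linarith
  refine ⟨e1, ?_⟩
  rw [e2, e3]
  ring

end Profile

/-! ### Extending frames over the tube -/

section TubeFrame

variable {r z : ℝ → ℝ}

/-- A smooth function that is `1` below `-7/4` and `0` above `-5/4`. -/
noncomputable def cutoff (t : ℝ) : ℝ := Real.smoothTransition (-2 * t - 5 / 2)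

theorem contDiff_cutoff : ContDiff ℝ ∞ cutoff :=
  Real.smoothTransition.contDiff.comp ((contDiff_const.mul contDiff_id).sub contDiff_const)

theorem cutoff_of_le {t : ℝ} (ht : t ≤ -(7 / 4)) : cutoff t = 1 :=
  Real.smoothTransition.one_of_one_le (by linarith)

theorem cutoff_of_ge {t : ℝ} (ht : -(5 / 4) ≤ t) : cutoff t = 0 :=
  Real.smoothTransition.zero_of_nonpos (by linarith)

theorem cutoff_mul_smul_mem {s t : ℝ} (ht : t ∈ Ioo (-2 : ℝ) 2) {u : Euc 2} (hu : ‖u‖ = 1) :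
    (cutoff s * t) • u ∈ ball (0 : Euc 2) 2 := by
  have h0 : 0 ≤ cutoff s := Real.smoothTransition.nonneg _
  have h1 : cutoff s ≤ 1 := Real.smoothTransition.le_one _
  have h2 : |t| < 2 := abs_lt.2 ht
  rw [mem_ball_zero_iff, norm_smul, hu, mul_one, Real.norm_eq_abs, abs_mul, abs_of_nonneg h0]
  nlinarith [abs_nonneg t]

/-- Frames that are transverse to the two ends of a tube, given in coordinates, and that match at
the axis, extend over the tube. -/
theorem IsTubeMap.exists_frame (h : IsTubeProfile r z) {T : Set (Euc 2)}
    (hT : UniqueDiffOn ℝ T) {q : Euc 2 → Model} {t : Euc 2 → ℝ} (hq : IsTubeMap r z T q t)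
    {a b : Fin 3 → Euc 2 → Model}
    (ha : ∀ i, ContDiffOn ℝ ∞ (a i) (ball 0 2)) (hb : ∀ i, ContDiffOn ℝ ∞ (b i) (ball 0 2))
    (ha0 : ∀ x ∈ ball (0 : Euc 2) 2, ∀ c : Fin 3 → ℝ, ∑ i, c i • (a i x).2 = 0 → c = 0)
    (hb0 : ∀ x ∈ ball (0 : Euc 2) 2, ∀ c : Fin 3 → ℝ, ∑ i, c i • (b i x).2 = 0 → c = 0)
    (hab : ∀ i, (b i 0).2 = (-(a i 0).2.1, (a i 0).2.2)) :
    ∃ c : Fin 3 → Euc 2 → Model, (∀ i, ContDiffOn ℝ ∞ (c i) T) ∧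
      (∀ x ∈ T, 7 / 4 ≤ ‖(q x).1‖ → (q x).2.1 = 0 → ∀ i, c i x = a i (q x).1) ∧
      (∀ x ∈ T, 7 / 4 ≤ ‖(q x).1‖ → (q x).2.1 = 1 → ∀ i, c i x = b i (q x).1) ∧
      ∀ x ∈ T, ∀ (e : Fin 3 → ℝ) (d : Euc 2),
        ∑ i, e i • c i x = fderivWithin ℝ q T x d → e = 0 := by
  have hne : ∀ x ∈ T, (q x).1 ≠ 0 := fun x hx h0 ↦ by
    have := h.r_pos (t x)
    rw [← hq.norm_eq x hx, h0, norm_zero] at this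
    exact lt_irrefl _ this
  let u : Euc 2 → Euc 2 := fun x ↦ direction (q x).1
  have hu1 : ∀ x ∈ T, ‖u x‖ = 1 := fun x hx ↦ norm_direction (hne x hx)
  have hu : ContDiffOn ℝ ∞ u T :=
    ((hq.smooth.fst.norm ℝ hne).inv fun x hx ↦ norm_ne_zero_iff.2 (hne x hx)).smul hq.smooth.fst
  let s₁ : Euc 2 → ℝ := fun x ↦ cutoff (t x)
  let s₂ : Euc 2 → ℝ := fun x ↦ cutoff (-t x)
  have hs₁ : ContDiffOn ℝ ∞ s₁ T := contDiff_cutoff.comp_contDiffOn hq.smooth_param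
  have hs₂ : ContDiffOn ℝ ∞ s₂ T := contDiff_cutoff.comp_contDiffOn hq.smooth_param.neg
  -- Radial contractions of the two ends: `y₁` is the point itself for `t ≤ -7/4`, where the radius
  -- is `-t`, and the centre for `t ≥ -5/4`; `y₂` is the mirror image at the other end.
  let y₁ : Euc 2 → Euc 2 := fun x ↦ (s₁ x * -t x) • u x
  let y₂ : Euc 2 → Euc 2 := fun x ↦ (s₂ x * t x) • u x
  have hy₁ : ContDiffOn ℝ ∞ y₁ T := (hs₁.mul hq.smooth_param.neg).smul hu
  have hy₂ : ContDiffOn ℝ ∞ y₂ T := (hs₂.mul hq.smooth_param).smul hu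
  have hy₁b : MapsTo y₁ T (ball 0 2) := fun x hx ↦ cutoff_mul_smul_mem (by
    have := hq.param_mem x hx
    exact ⟨by linarith [this.2], by linarith [this.1]⟩) (hu1 x hx)
  have hy₂b : MapsTo y₂ T (ball 0 2) := fun x hx ↦ cutoff_mul_smul_mem (hq.param_mem x hx) (hu1 x hx)
  have ha' : ∀ i, ContDiffOn ℝ ∞ (fun x ↦ a i (y₁ x)) T := fun i ↦ (ha i).comp hy₁ hy₁b
  have hb' : ∀ i, ContDiffOn ℝ ∞ (fun x ↦ b i (y₂ x)) T := fun i ↦ (hb i).comp hy₂ hy₂b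
  -- `A` and `B` are the coefficients along the profile normal and in the `w`-directions. At most
  -- one of `y₁`, `y₂` is nonzero; by `hab` the subtracted constant cancels the contribution of the
  -- other end.
  let A : Fin 3 → Euc 2 → ℝ := fun i x ↦ -(a i (y₁ x)).2.1 + (b i (y₂ x)).2.1 - (b i 0).2.1
  let B : Fin 3 → Euc 2 → Euc 2 := fun i x ↦ (a i (y₁ x)).2.2 + (b i (y₂ x)).2.2 - (b i 0).2.2
  have hA : ∀ i, ContDiffOn ℝ ∞ (A i) T := fun i ↦
    ((ha' i).snd.fst.neg.add (hb' i).snd.fst).sub contDiffOn_const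
  have hB : ∀ i, ContDiffOn ℝ ∞ (B i) T := fun i ↦
    ((ha' i).snd.snd.add (hb' i).snd.snd).sub contDiffOn_const
  have hdr : ContDiffOn ℝ ∞ (fun x ↦ deriv r (t x)) T :=
    ((contDiff_infty_iff_deriv.1 h.smooth_r).2).comp_contDiffOn hq.smooth_param
  have hdz : ContDiffOn ℝ ∞ (fun x ↦ deriv z (t x)) T :=
    ((contDiff_infty_iff_deriv.1 h.smooth_z).2).comp_contDiffOn hq.smooth_param
  -- The horizontal parts are needed only to reproduce `a` and `b` at the ends. They are faded out
  -- while the surface is still horizontal, which is what `hPz` expresses.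
  let P : Fin 3 → Euc 2 → Euc 2 := fun i x ↦ s₁ x • (a i (y₁ x)).1 + s₂ x • (b i (y₂ x)).1
  have hP : ∀ i, ContDiffOn ℝ ∞ (P i) T := fun i ↦
    (hs₁.smul (ha' i).fst).add (hs₂.smul (hb' i).fst)
  -- The values on the two halves of the tube.
  have hneg : ∀ x, t x ≤ 0 → s₂ x = 0 ∧ (∀ i, A i x = -(a i (y₁ x)).2.1) ∧
      ∀ i, B i x = (a i (y₁ x)).2.2 := by
    intro x hx
    have h1 : s₂ x = 0 := cutoff_of_ge (by linarith)
    have h2 : y₂ x = 0 := by simp [y₂, h1]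
    exact ⟨h1, fun i ↦ by simp [A, h2], fun i ↦ by simp [B, h2]⟩
  have hpos : ∀ x, 0 ≤ t x → s₁ x = 0 ∧ (∀ i, A i x = (b i (y₂ x)).2.1) ∧
      ∀ i, B i x = (b i (y₂ x)).2.2 := by
    intro x hx
    have h1 : s₁ x = 0 := cutoff_of_ge (by linarith)
    have h2 : y₁ x = 0 := by simp [y₁, h1]
    exact ⟨h1, fun i ↦ by simp [A, h2, hab i], fun i ↦ by simp [B, h2, hab i]⟩
  have hAB : ∀ x ∈ T, ∀ e : Fin 3 → ℝ, ∑ i, e i * A i x = 0 → ∑ i, e i • B i x = 0 → e = 0 := by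
    intro x hx e h1 h2
    rcases le_total (t x) 0 with ht | ht
    · refine ha0 (y₁ x) (hy₁b hx) e (Prod.ext ?_ ?_)
      · simp only [(hneg x ht).2.1, mul_neg, Finset.sum_neg_distrib, neg_eq_zero] at h1
        simpa [Prod.fst_sum] using h1
      · simp only [(hneg x ht).2.2] at h2
        simpa [Prod.snd_sum] using h2
    · refine hb0 (y₂ x) (hy₂b hx) e (Prod.ext ?_ ?_)
      · simp only [(hpos x ht).2.1] at h1
        simpa [Prod.fst_sum] using h1
      · simp only [(hpos x ht).2.2] at h2
        simpa [Prod.snd_sum] using h2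
  have hPz : ∀ i x, deriv z (t x) • P i x = 0 := by
    intro i x
    rcases lt_or_ge (t x) (-(5 / 4)) with h1 | h1
    · rw [(h.deriv_of_lt (by linarith)).2, zero_smul]
    rcases lt_or_ge (5 / 4) (t x) with h2 | h2
    · rw [(h.deriv_of_gt (by linarith)).2, zero_smul]
    have h3 : s₁ x = 0 := cutoff_of_ge h1
    have h4 : s₂ x = 0 := cutoff_of_ge (by linarith)
    simp [P, h3, h4]
  have hrange : ∀ x ∈ T, 7 / 4 ≤ ‖(q x).1‖ → t x < -1 ∨ 1 < t x := by
    intro x hx h1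
    by_contra! h2
    have := h.r_le_one h2.1 h2.2
    rw [hq.norm_eq x hx] at h1
    linarith
  -- The vector `(-z' u, r')` is normal to the tube in the profile plane. It points down on the
  -- incoming sheet, where `r' = -1`, and up on the outgoing one; this is the origin of the sign in
  -- `hab`.
  refine ⟨fun i x ↦ (P i x - (A i x * deriv z (t x)) • u x, A i x * deriv r (t x), B i x),
    fun i ↦ ((hP i).sub (((hA i).mul hdz).smul hu)).prodMk (((hA i).mul hdr).prodMk (hB i)),
    ?_, ?_, ?_⟩
  · intro x hx h1 h2 i
    rcases hrange x hx h1 with h3 | h3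
    · have h4 : ‖(q x).1‖ = -t x := by rw [hq.norm_eq x hx, (h.incoming _ h3.le).1]
      have h5 : s₁ x = 1 := cutoff_of_le (by linarith)
      have h6 : y₁ x = (q x).1 := by
        simp only [y₁, h5, one_mul, ← h4]
        exact norm_smul_direction (hne x hx)
      obtain ⟨h7, h8, h9⟩ := hneg x (by linarith)
      simp only [P, h5, h7, h8, h9, h6, (h.deriv_of_lt h3).1, (h.deriv_of_lt h3).2]
      simp
    · have := (h.outgoing _ h3.le).2
      rw [← hq.height_eq x hx, h2] at this
      norm_num at this
  · intro x hx h1 h2 i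
    rcases hrange x hx h1 with h3 | h3
    · have := (h.incoming _ h3.le).2
      rw [← hq.height_eq x hx, h2] at this
      norm_num at this
    · have h4 : ‖(q x).1‖ = t x := by rw [hq.norm_eq x hx, (h.outgoing _ h3.le).1]
      have h5 : s₂ x = 1 := cutoff_of_le (by linarith)
      have h6 : y₂ x = (q x).1 := by
        simp only [y₂, h5, one_mul, ← h4]
        exact norm_smul_direction (hne x hx)
      obtain ⟨h7, h8, h9⟩ := hpos x (by linarith)
      simp only [P, h5, h7, h8, h9, h6, (h.deriv_of_gt h3).1, (h.deriv_of_gt h3).2]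
      simp
  · intro x hx e d hed
    obtain ⟨k1, k2⟩ := hq.fderivWithin_apply h hT hx d
    rw [← hed] at k1 k2
    have e22 : (∑ i, e i • ((P i x - (A i x * deriv z (t x)) • u x, A i x * deriv r (t x), B i x) :
        Model)).2.2 = ∑ i, e i • B i x := by
      simp [Prod.snd_sum]
    have e21 : (∑ i, e i • ((P i x - (A i x * deriv z (t x)) • u x, A i x * deriv r (t x), B i x) :
        Model)).2.1 = (∑ i, e i * A i x) * deriv r (t x) := by
      simp [Prod.snd_sum, Prod.fst_sum, Finset.sum_mul, mul_assoc]
    have e1 : (∑ i, e i • ((P i x - (A i x * deriv z (t x)) • u x, A i x * deriv r (t x), B i x) :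
        Model)).1 = ∑ i, e i • P i x - ((∑ i, e i * A i x) * deriv z (t x)) • u x := by
      simp only [Prod.fst_sum, Prod.smul_fst, smul_sub, Finset.sum_sub_distrib, smul_smul,
        Finset.sum_mul, Finset.sum_smul, mul_assoc]
    rw [e22] at k1
    rw [e21, e1] at k2
    refine hAB x hx e ?_ k1
    have k3 : deriv z (t x) * inner ℝ (u x) (∑ i, e i • P i x) = 0 := by
      rw [← real_inner_smul_right, Finset.smul_sum]
      simp only [smul_comm (deriv z (t x)), hPz, smul_zero, Finset.sum_const_zero, inner_zero_right]
    have k4 : inner ℝ (u x) (u x) = (1 : ℝ) := by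
      rw [real_inner_self_eq_norm_sq, hu1 x hx]; norm_num
    change _ = deriv z (t x) * inner ℝ (u x) _ at k2
    rw [inner_sub_right, real_inner_smul_right, k4, mul_sub, k3] at k2
    -- A tangent vector is orthogonal to the profile normal, whose squared length `r'² + z'²` is
    -- positive by regularity.
    have k5 : (∑ i, e i * A i x) * (deriv r (t x) ^ 2 + deriv z (t x) ^ 2) = 0 := by
      linear_combination k2
    refine (mul_eq_zero.1 k5).resolve_right ?_
    rcases h.regular (t x) with h0 | h0
    · have := sq_pos_of_ne_zero h0
      positivity
    · have := sq_pos_of_ne_zero h0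
      positivity

end TubeFrame

/-! ### Transferring normal frames between parametrizations -/

section Transfer

variable {M H W : Type*} [TopologicalSpace M] [ChartedSpace (Euc 2) M]
  [TopologicalSpace H] {I : ModelWithCorners ℝ (Euc 5) H}
  [TopologicalSpace W] [ChartedSpace H W] [IsManifold I ∞ W]

theorem IsNormalFrame.congr {f : M → W} {S T : Set M} {V V' : Fin 3 → M → Euc 5}
    (h : IsNormalFrame I f S T V) (hV : ∀ i, ∀ x ∈ T, V' i x = V i x) :
    IsNormalFrame I f S T V' := by
  refine ⟨fun i ↦ (h.smooth i).congr (fun _ _ ↦ rfl) (hV i), fun x hx c d hcd ↦ ?_⟩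
  simp only [fun i ↦ hV i x hx] at hcd
  exact h.eq_zero x hx c d hcd

theorem IsNormalFrame.of_locally {f : M → W} {S T : Set M} {V : Fin 3 → M → Euc 5}
    (h : ∀ x ∈ T, ∃ u, IsOpen u ∧ x ∈ u ∧ IsNormalFrame I f S (T ∩ u) V) :
    IsNormalFrame I f S T V := by
  refine ⟨fun i ↦ SmoothAlong.of_locally fun x hx ↦ ?_, fun x hx ↦ ?_⟩
  · obtain ⟨u, hu, hxu, hV⟩ := h x hx
    exact ⟨u, hu, hxu, hV.smooth i⟩
  · obtain ⟨u, hu, hxu, hV⟩ := h x hx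
    exact hV.eq_zero x ⟨hx, hxu⟩

variable [IsManifold 𝓘(ℝ, Euc 2) ∞ M] [T2Space W]

theorem IsSurface.exists_differential_lift {f : M → W} {S : Set M} (hf : IsSurface I f S)
    {f' : Euc 2 → W} (hf' : IsEmbeddedDisk I f') {u : Set (Euc 2)} (hu : IsOpen u)
    {g : Euc 2 → M} (hgS : MapsTo g (disk ∩ u) S) (hfg : ∀ x ∈ disk ∩ u, f (g x) = f' x)
    {x : Euc 2} (hx : x ∈ disk ∩ u) :
    differential 𝓘(ℝ, Euc 2) I f' disk x = (differential 𝓘(ℝ, Euc 2) I f S (g x)).comp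
      (differential 𝓘(ℝ, Euc 2) 𝓘(ℝ, Euc 2) g (disk ∩ u) x) := by
  rw [← differential_inter hu hx.2]
  exact differential_of_eq_comp hf.smooth
    (hf.contMDiffOn_lift (uniqueDiffOn_disk.inter hu) hgS (hf'.smooth.mono inter_subset_left) hfg)
    (uniqueMDiffOn_disk.inter hu) hgS (fun y hy ↦ (hfg y hy).symm) hx

/-- The chain rule gives one inclusion; both planes have dimension 2. -/
theorem IsSurface.range_differential_lift {f : M → W} {S : Set M} (hf : IsSurface I f S)
    {f' : Euc 2 → W} (hf' : IsEmbeddedDisk I f') {u : Set (Euc 2)} (hu : IsOpen u)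
    {g : Euc 2 → M} (hgS : MapsTo g (disk ∩ u) S) (hfg : ∀ x ∈ disk ∩ u, f (g x) = f' x)
    {x : Euc 2} (hx : x ∈ disk ∩ u) :
    LinearMap.range (differential 𝓘(ℝ, Euc 2) I f' disk x).toLinearMap =
      LinearMap.range (differential 𝓘(ℝ, Euc 2) I f S (g x)).toLinearMap := by
  apply Submodule.eq_of_le_of_finrank_eq
  · rw [hf.exists_differential_lift hf' hu hgS hfg hx]
    exact LinearMap.range_comp_le_range _ _
  · rw [LinearMap.finrank_range_of_inj (hf'.injective_differential hx.1),
      LinearMap.finrank_range_of_inj (hf.immersive _ (hgS hx))]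

theorem IsNormalFrame.lift {f : M → W} {S : Set M} (hf : IsSurface I f S)
    {V : Fin 3 → M → Euc 5} (hV : IsNormalFrame I f S S V)
    {f' : Euc 2 → W} (hf' : IsEmbeddedDisk I f') {u : Set (Euc 2)} (hu : IsOpen u)
    {g : Euc 2 → M} (hgS : MapsTo g (disk ∩ u) S) (hfg : ∀ x ∈ disk ∩ u, f (g x) = f' x) :
    IsNormalFrame I f' disk (disk ∩ u) fun i x ↦ V i (g x) := by
  refine ⟨fun i ↦ ?_, fun x hx c d hcd ↦ ?_⟩
  · exact ((hV.smooth i).comp (hf.contMDiffOn_lift (uniqueDiffOn_disk.inter hu) hgS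
      (hf'.smooth.mono inter_subset_left) hfg) hgS).congr (fun x hx ↦ (hfg x hx).symm)
      fun _ _ ↦ rfl
  · rw [hf.exists_differential_lift hf' hu hgS hfg hx] at hcd
    exact hV.eq_zero (g x) (hgS hx) c _ hcd

end Transfer

/-! ### The normal frame of the tubed disk -/

section Tube

variable {H W : Type*} [TopologicalSpace H] {I : ModelWithCorners ℝ (Euc 5) H}
  [TopologicalSpace W] [ChartedSpace H W] [IsManifold I ∞ W]

theorem sum_smul_quotient_mk {κ E : Type*} [Fintype κ] [AddCommGroup E] [Module ℝ E]
    (N : Submodule ℝ E) (c : κ → ℝ) (v : κ → E) :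
    ∑ i, c i • (Submodule.Quotient.mk (v i) : E ⧸ N) = Submodule.Quotient.mk (∑ i, c i • v i) := by
  simp only [← Submodule.mkQ_apply, map_sum, map_smul]

theorem HasTrivialNormalBundle.exists_isNormalFrame {R : Sph → W}
    (h : HasTrivialNormalBundle (𝓡 2) I 3 R) : ∃ F, IsNormalFrame I R univ univ F := by
  obtain ⟨φ, hφ⟩ := h
  choose F hF hφF using hφ.smooth
  refine ⟨F, hF, fun x hx c d hcd ↦ ?_⟩
  refine funext (Fintype.linearIndependent_iff.1 (hφ.linearIndependent x hx) c ?_)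
  simp only [hφF _ x hx]
  rw [sum_smul_quotient_mk]
  exact (Submodule.Quotient.mk_eq_zero _).2 ⟨d, hcd.symm⟩

/-- The block contains the tube and reaches out to radius `7 / 4`, beyond which the frame on the
tube equals the given frames. Compactness makes its image closed in `W`. -/
theorem isCompact_tubeBlock :
    IsCompact {q : Model | ‖q.1‖ ≤ 7 / 4 ∧ 0 ≤ q.2.1 ∧ q.2.1 ≤ 1 ∧ q.2.2 = 0} := by
  have : {q : Model | ‖q.1‖ ≤ 7 / 4 ∧ 0 ≤ q.2.1 ∧ q.2.1 ≤ 1 ∧ q.2.2 = 0} =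
      closedBall (0 : Euc 2) (7 / 4) ×ˢ (Icc (0 : ℝ) 1 ×ˢ {(0 : Euc 2)}) := by
    ext q
    simp [mem_prod, and_assoc]
  rw [this]
  exact (isCompact_closedBall _ _).prod (isCompact_Icc.prod isCompact_singleton)

/-- A matrix that transforms one basis into another. -/
theorem exists_transform {F : Type*} [NormedAddCommGroup F] [NormedSpace ℝ F]
    [FiniteDimensional ℝ F] (hF : Module.finrank ℝ F = 3) {β κ : Fin 3 → F}
    (hβ : ∀ c : Fin 3 → ℝ, ∑ i, c i • β i = 0 → c = 0)
    (hκ : ∀ c : Fin 3 → ℝ, ∑ i, c i • κ i = 0 → c = 0) :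
    ∃ C : Fin 3 → Fin 3 → ℝ, (∀ i, ∑ j, C i j • β j = κ i) ∧
      ∀ c : Fin 3 → ℝ, (∀ j, ∑ i, c i * C i j = 0) → c = 0 := by
  obtain ⟨e, he⟩ := exists_equiv_eq_comb (Fintype.linearIndependent_iff.2
    fun c hc i ↦ congrFun (hβ c hc) i) (by simp [hF])
  have hC : ∀ i, ∑ j, e.symm (κ i) j • β j = κ i := fun i ↦ by
    rw [← comb_apply, ← he]
    simp
  refine ⟨fun i ↦ e.symm (κ i), hC, fun c hc ↦ hκ c ?_⟩
  calc ∑ i, c i • κ i = ∑ i, c i • ∑ j, e.symm (κ i) j • β j := by simp only [hC]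
    _ = ∑ j, (∑ i, c i * e.symm (κ i) j) • β j := by
      simp only [Finset.smul_sum, Finset.sum_smul, smul_smul]
      exact Finset.sum_comm
    _ = 0 := by simp [hc]

/-- A frame of a disk induces a frame of the disk that is tubed to a sphere with trivial normal
bundle; both agree at the boundary. -/
theorem IsTubing.exists_isNormalFrame [T2Space W] {f f' : Euc 2 → W} {R : Sph → W}
    (hf : IsEmbeddedDisk I f) (hR : Manifold.IsSmoothEmbedding (𝓡 2) I ∞ R)
    (hRtriv : HasTrivialNormalBundle (𝓡 2) I 3 R) (hRf : Disjoint (range R) (f '' disk))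
    (htube : IsTubing I f R f') {V : Fin 3 → Euc 2 → Euc 5}
    (hV : IsNormalFrame I f disk disk V) :
    ∃ V', IsNormalFrame I f' disk disk V' ∧
      ∀ x ∈ sphere (0 : Euc 2) 1, ∀ y ∈ sphere (0 : Euc 2) 1, f' x = f y →
        (∀ i, V' i x = V i y) ∧
        LinearMap.range (differential 𝓘(ℝ, Euc 2) I f' disk x).toLinearMap =
          LinearMap.range (differential 𝓘(ℝ, Euc 2) I f disk y).toLinearMap := by
  obtain ⟨hf', hbd, Ψ, r, z, hsrc, hΨ1, hΨ2, hΨf, hΨR, hΨd, hprof, himg⟩ := htube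
  have hΨ : IsBoxChart I Ψ := ⟨hsrc, hΨ1, hΨ2⟩
  have hfs := hf.isSurface
  have hRs := isSurface_of_isSmoothEmbedding hR
  -- The frames of the disk and of the sphere, in box coordinates.
  obtain ⟨a, ha, haV, ha0⟩ := hV.exists_boxCoord hΨ hfs (z := 0) (by norm_num) (by norm_num)
    fun x hx ↦ (hΨf _ (mem_modelBox hx (by norm_num) (by norm_num))).2 ⟨rfl, rfl⟩
  have hsheetR : ∀ x ∈ ball (0 : Euc 2) 2, Ψ (x, 1, 0) ∈ R '' univ := fun x hx ↦ by
    rw [image_univ]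
    exact (hΨR _ (mem_modelBox hx (by norm_num) (by norm_num))).2 ⟨rfl, rfl⟩
  have h02 : (0 : Euc 2) ∈ ball (0 : Euc 2) 2 := by simp
  obtain ⟨U, hU, b, hb, hbU, hb0, hab⟩ : ∃ (U : Fin 3 → Sph → Euc 5)
      (_ : IsNormalFrame I R univ univ U) (b : Fin 3 → Euc 2 → Model),
      (∀ i, ContDiffOn ℝ ∞ (b i) (ball 0 2)) ∧
      (∀ x ∈ ball (0 : Euc 2) 2, ∀ y ∈ univ, R y = Ψ (x, 1, 0) →
        ∀ i, U i y = boxDiff I Ψ (x, 1, 0) (b i x)) ∧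
      (∀ x ∈ ball (0 : Euc 2) 2, ∀ c : Fin 3 → ℝ, ∑ i, c i • (b i x).2 = 0 → c = 0) ∧
      ∀ i, (b i 0).2 = (-(a i 0).2.1, (a i 0).2.2) := by
    obtain ⟨F, hF⟩ := hRtriv.exists_isNormalFrame
    obtain ⟨b₀, -, hb₀F, hb₀0⟩ := hF.exists_boxCoord hΨ hRs (z := 1) (by norm_num) (by norm_num)
      hsheetR
    -- The components transverse to the sphere at the end of the axis form a basis of `ℝ × ℝ²`. `C`
    -- turns it into the basis coming from the disk, with the `z`-component reversed.
    obtain ⟨C, hC1, hC2⟩ := exists_transform (F := ℝ × Euc 2) (by simp) (hb₀0 0 h02)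
      (κ := fun i ↦ (-(a i 0).2.1, (a i 0).2.2)) (by
        intro c hc
        refine ha0 0 h02 c (Prod.ext ?_ ?_)
        · have := congrArg Prod.fst hc
          simpa [Prod.fst_sum] using this
        · have := congrArg Prod.snd hc
          simpa [Prod.snd_sum] using this)
    have hU := hF.transform hC2
    obtain ⟨b, hb, hbU, hb0⟩ := hU.exists_boxCoord hΨ hRs (z := 1) (by norm_num) (by norm_num)
      hsheetR
    refine ⟨_, hU, b, hb, hbU, hb0, fun i ↦ ?_⟩
    obtain ⟨y, -, hy⟩ := hsheetR 0 h02
    have hbox : ((0, 1, 0) : Model) ∈ Ψ.source :=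
      hsrc ▸ mem_modelBox h02 (by norm_num) (by norm_num)
    have h1 := hbU 0 h02 y (mem_univ _) hy i
    simp only [hb₀F 0 h02 y (mem_univ _) hy, ← map_smul, ← map_sum] at h1
    have h2 := congrArg (boxDiffSymm I Ψ (Ψ (0, 1, 0))) h1
    rw [hΨ.boxDiffSymm_boxDiff hbox, hΨ.boxDiffSymm_boxDiff hbox] at h2
    rw [← h2, Prod.snd_sum]
    exact hC1 i
  -- The part of the new disk in the box.
  obtain ⟨u, hu, huT⟩ := continuousOn_iff'.1 hf'.smooth.continuousOn _ Ψ.open_target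
  have huT' : ∀ x ∈ disk, x ∈ u ↔ f' x ∈ Ψ.target := fun x hx ↦
    ⟨fun h ↦ (huT.symm.subset ⟨h, hx⟩).1, fun h ↦ (huT.subset ⟨h, hx⟩).1⟩
  let q : Euc 2 → Model := fun x ↦ Ψ.symm (f' x)
  have hqbox : ∀ x ∈ disk ∩ u, q x ∈ modelBox := fun x hx ↦
    hsrc ▸ Ψ.map_target ((huT' x hx.1).1 hx.2)
  have hqf : ∀ x ∈ disk ∩ u, Ψ (q x) = f' x := fun x hx ↦
    Ψ.right_inv ((huT' x hx.1).1 hx.2)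
  have hqsm : ContDiffOn ℝ ∞ q (disk ∩ u) :=
    (hΨ2.comp (hf'.smooth.mono inter_subset_left)
      fun x hx ↦ (huT' x hx.1).1 hx.2).contDiffOn
  have htubebox : ∀ p ∈ modelTube r z, p ∈ modelBox ∧ ‖p.1‖ ≤ 1 ∧ 0 ≤ p.2.1 ∧ p.2.1 ≤ 1 ∧
      p.2.2 = 0 := by
    rintro p ⟨t, ht, h1, h2, h3⟩
    have hr := hprof.r_le_one ht.1 ht.2
    have hz : 0 ≤ z t ∧ z t ≤ 1 := by
      rcases ht.1.eq_or_lt with h | h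
      · rw [← h, (hprof.incoming _ le_rfl).2]; norm_num
      rcases ht.2.eq_or_lt with h' | h'
      · rw [h', (hprof.outgoing _ le_rfl).2]; norm_num
      exact (hprof.middle t h h').2.2
    have hz1 := hz.1
    have hz2 := hz.2
    rw [← h2] at hz1 hz2
    rw [← h1] at hr
    refine ⟨⟨by linarith, by linarith, by linarith, ?_⟩, hr, hz1, hz2, h3⟩
    rw [h3, norm_zero]; norm_num
  have hmem : ∀ x ∈ disk, (f' x ∈ f '' disk ∧ f' x ∉ Ψ '' modelDisk 0) ∨
      (f' x ∈ range R ∧ f' x ∉ Ψ '' modelDisk 1) ∨ f' x ∈ Ψ '' modelTube r z := by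
    intro x hx
    have : f' x ∈ f' '' disk := mem_image_of_mem _ hx
    rw [himg] at this
    rcases this with (h | h) | h
    exacts [Or.inl h, Or.inr (Or.inl h), Or.inr (Or.inr h)]
  -- Outside the removed disks, the sheets of Δ and of the sphere prolong the tube, with parameter
  -- minus the radius on the former and the radius on the latter.
  have hqt : ∀ x ∈ disk ∩ u, ∃ t ∈ Ioo (-2 : ℝ) 2,
      ‖(q x).1‖ = r t ∧ (q x).2.1 = z t ∧ (q x).2.2 = 0 := by
    intro x hx
    have hn : ‖(q x).1‖ < 2 := (hqbox x hx).1
    rcases hmem x hx.1 with ⟨h1, h2⟩ | ⟨h1, h2⟩ | ⟨p, hp, hpx⟩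
    · rw [← hqf x hx, hΨf _ (hqbox x hx)] at h1
      have h3 : 1 ≤ ‖(q x).1‖ := by
        by_contra! h4
        exact h2 ⟨q x, ⟨h4, h1.1, h1.2⟩, hqf x hx⟩
      have h5 := hprof.incoming (-‖(q x).1‖) (by linarith)
      exact ⟨-‖(q x).1‖, ⟨by linarith, by linarith⟩, by rw [h5.1, neg_neg], by rw [h5.2, h1.1], h1.2⟩
    · rw [← hqf x hx, hΨR _ (hqbox x hx)] at h1
      have h3 : 1 ≤ ‖(q x).1‖ := by
        by_contra! h4
        exact h2 ⟨q x, ⟨h4, h1.1, h1.2⟩, hqf x hx⟩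
      have h5 := hprof.outgoing ‖(q x).1‖ h3
      exact ⟨‖(q x).1‖, ⟨by linarith, hn⟩, h5.1.symm, by rw [h5.2, h1.1], h1.2⟩
    · have hpq : q x = p := by
        simp only [q, ← hpx]
        exact Ψ.left_inv (hsrc ▸ (htubebox p hp).1)
      obtain ⟨t, ht, h1, h2, h3⟩ := hp
      rw [hpq]
      exact ⟨t, ⟨by linarith [ht.1], by linarith [ht.2]⟩, h1, h2, h3⟩
  have hTu : UniqueDiffOn ℝ (disk ∩ u) := uniqueDiffOn_disk.inter hu
  obtain ⟨t, hqtube⟩ := hprof.exists_isTubeMap hTu hqsm hqt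
  obtain ⟨c, hc, hca, hcb, hc0⟩ := hqtube.exists_frame hprof hTu ha hb ha0 hb0 hab
  have hframeT : IsNormalFrame I f' disk (disk ∩ u) fun i x ↦ boxDiff I Ψ (q x) (c i x) := by
    have hmaps : MapsTo q (disk ∩ u) Ψ.source := fun x hx ↦ hsrc ▸ hqbox x hx
    refine ⟨fun i ↦ ?_, fun x hx e d hed ↦ ?_⟩
    · exact (SmoothAlong.map_differential hΨ1 Ψ.open_source.uniqueMDiffOn
        (smoothAlong_vectorSpace_iff.2 ⟨hqsm.contMDiffOn, (hc i).contMDiffOn⟩) hmaps).congr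
          (fun x hx ↦ (hqf x hx).symm) fun _ _ ↦ rfl
    · have h1 := differential_of_eq_comp (h := f') hΨ1 hqsm.contMDiffOn
        (uniqueMDiffOn_disk.inter hu) hmaps (fun y hy ↦ (hqf y hy).symm) hx
      rw [differential_inter hu hx.2, differential_eq_fderivWithin] at h1
      rw [h1] at hed
      simp only [← map_smul, ← map_sum] at hed
      refine hc0 x hx e d ?_
      have h2 := congrArg (boxDiffSymm I Ψ (Ψ (q x))) hed
      rw [hΨ.boxDiffSymm_boxDiff (hmaps hx)] at h2
      rw [h2]
      exact hΨ.boxDiffSymm_boxDiff (hmaps hx) _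
  -- The parts of the new disk outside of the tube.
  set K : Set Model := {q : Model | ‖q.1‖ ≤ 7 / 4 ∧ 0 ≤ q.2.1 ∧ q.2.1 ≤ 1 ∧ q.2.2 = 0} with hK
  have hKbox : K ⊆ Ψ.source := by
    rintro p ⟨h1, h2, h3, h4⟩
    rw [hsrc]
    exact ⟨by linarith, by linarith, by linarith, by rw [h4, norm_zero]; norm_num⟩
  have hKc : IsClosed (Ψ '' K) :=
    (isCompact_tubeBlock.image_of_continuousOn (Ψ.continuousOn.mono hKbox)).isClosed
  have hKtarget : Ψ '' K ⊆ Ψ.target := by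
    rintro - ⟨p, hp, rfl⟩
    exact Ψ.map_source (hKbox hp)
  have htubeK : Ψ '' modelTube r z ⊆ Ψ '' K := image_mono fun p hp ↦ by
    obtain ⟨-, h1, h2⟩ := htubebox p hp
    exact ⟨by linarith, h2⟩
  have hRc : IsClosed (range R) := (isCompact_range hR.contMDiff.continuous).isClosed
  have hfc : IsClosed (f '' disk) :=
    (hfs.isCompact.image_of_continuousOn hf.smooth.continuousOn).isClosed
  -- `uf` avoids the sphere and the block, so there the new disk runs in the old one; `uR` does so
  -- with the roles of sphere and disk exchanged. Together with `u` they cover the disk, because the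
  -- sphere misses Δ.
  obtain ⟨uf, huf, huf'⟩ := continuousOn_iff'.1 hf'.smooth.continuousOn _
    (hRc.union hKc).isOpen_compl
  obtain ⟨uR, huR, huR'⟩ := continuousOn_iff'.1 hf'.smooth.continuousOn _
    (hfc.union hKc).isOpen_compl
  have huf1 : ∀ x ∈ disk, x ∈ uf ↔ f' x ∉ range R ∧ f' x ∉ Ψ '' K := fun x hx ↦ by
    rw [← not_or]
    exact ⟨fun h ↦ (huf'.symm.subset ⟨h, hx⟩).1, fun h ↦ (huf'.subset ⟨h, hx⟩).1⟩
  have huR1 : ∀ x ∈ disk, x ∈ uR ↔ f' x ∉ f '' disk ∧ f' x ∉ Ψ '' K := fun x hx ↦ by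
    rw [← not_or]
    exact ⟨fun h ↦ (huR'.symm.subset ⟨h, hx⟩).1, fun h ↦ (huR'.subset ⟨h, hx⟩).1⟩
  have huf2 : ∀ x ∈ disk ∩ uf, f' x ∈ f '' disk := by
    intro x hx
    have h1 := (huf1 x hx.1).1 hx.2
    rcases hmem x hx.1 with h | h | h
    exacts [h.1, (h1.1 h.1).elim, (h1.2 (htubeK h)).elim]
  have huR2 : ∀ x ∈ disk ∩ uR, f' x ∈ range R := by
    intro x hx
    have h1 := (huR1 x hx.1).1 hx.2
    rcases hmem x hx.1 with h | h | h
    exacts [(h1.1 h.1).elim, h.1, (h1.2 (htubeK h)).elim]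
  let g : Euc 2 → Euc 2 := fun x ↦ Function.invFunOn f disk (f' x)
  have hg : MapsTo g (disk ∩ uf) disk := fun x hx ↦ Function.invFunOn_mem (huf2 x hx)
  have hfg : ∀ x ∈ disk ∩ uf, f (g x) = f' x := fun x hx ↦ Function.invFunOn_eq (huf2 x hx)
  have : Nonempty Sph := ⟨(hsheetR 0 h02).choose⟩
  let gR : Euc 2 → Sph := fun x ↦ Function.invFun R (f' x)
  have hgR : ∀ x ∈ disk ∩ uR, R (gR x) = f' x := fun x hx ↦ Function.invFun_eq (huR2 x hx)
  classical
  -- The case distinction is harmless: on the overlaps the radius is at least `7 / 4`, where the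
  -- tube frame equals the frame of the disk or of the sphere.
  let V' : Fin 3 → Euc 2 → Euc 5 := fun i x ↦
    if f' x ∈ Ψ.target then boxDiff I Ψ (q x) (c i x)
    else if f' x ∈ f '' disk then V i (g x) else U i (gR x)
  have hV'T : ∀ i, ∀ x ∈ disk ∩ u, V' i x = boxDiff I Ψ (q x) (c i x) := fun i x hx ↦
    if_pos ((huT' x hx.1).1 hx.2)
  have hfar : ∀ x ∈ disk ∩ u, f' x ∉ Ψ '' K → (q x).2.1 = 0 ∨ (q x).2.1 = 1 →
      (q x).2.2 = 0 → 7 / 4 ≤ ‖(q x).1‖ := by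
    intro x hx h1 h2 h3
    by_contra! h4
    refine h1 ⟨q x, ⟨h4.le, ?_, ?_, h3⟩, hqf x hx⟩ <;> rcases h2 with h | h <;> rw [h] <;> norm_num
  have hV'f : ∀ i, ∀ x ∈ disk ∩ uf, V' i x = V i (g x) := by
    intro i x hx
    by_cases hxT : f' x ∈ Ψ.target
    · have hxu : x ∈ disk ∩ u := ⟨hx.1, (huT' x hx.1).2 hxT⟩
      have h1 := huf2 x hx
      rw [← hqf x hxu, hΨf _ (hqbox x hxu)] at h1
      have h2 := hfar x hxu ((huf1 x hx.1).1 hx.2).2 (Or.inl h1.1) h1.2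
      have h3 : q x = ((q x).1, 0, 0) := Prod.ext rfl (Prod.ext h1.1 h1.2)
      have h4 : (q x).1 ∈ ball (0 : Euc 2) 2 := by
        rw [mem_ball_zero_iff]; exact (hqbox x hxu).1
      rw [hV'T i x hxu, hca x hxu h2 h1.1 i,
        haV (q x).1 h4 (g x) (hg hx) (by rw [hfg x hx, ← h3, hqf x hxu]) i, ← h3]
    · simp only [V', if_neg hxT, if_pos (huf2 x hx)]
  have hV'R : ∀ i, ∀ x ∈ disk ∩ uR, V' i x = U i (gR x) := by
    intro i x hx
    by_cases hxT : f' x ∈ Ψ.target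
    · have hxu : x ∈ disk ∩ u := ⟨hx.1, (huT' x hx.1).2 hxT⟩
      have h1 := huR2 x hx
      rw [← hqf x hxu, hΨR _ (hqbox x hxu)] at h1
      have h2 := hfar x hxu ((huR1 x hx.1).1 hx.2).2 (Or.inr h1.1) h1.2
      have h3 : q x = ((q x).1, 1, 0) := Prod.ext rfl (Prod.ext h1.1 h1.2)
      have h4 : (q x).1 ∈ ball (0 : Euc 2) 2 := by
        rw [mem_ball_zero_iff]; exact (hqbox x hxu).1
      rw [hV'T i x hxu, hcb x hxu h2 h1.1 i,
        hbU (q x).1 h4 (gR x) (mem_univ _) (by rw [hgR x hx, ← h3, hqf x hxu]) i, ← h3]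
    · simp only [V', if_neg hxT, if_neg ((huR1 x hx.1).1 hx.2).1]
  refine ⟨V', IsNormalFrame.of_locally fun x hx ↦ ?_, fun x hx y hy hxy ↦ ?_⟩
  · by_cases hxT : f' x ∈ Ψ.target
    · exact ⟨u, hu, (huT' x hx).2 hxT, hframeT.congr hV'T⟩
    have hxK : f' x ∉ Ψ '' K := fun h ↦ hxT (hKtarget h)
    rcases hmem x hx with h | h | h
    · exact ⟨uf, huf, (huf1 x hx).2 ⟨fun h' ↦ disjoint_left.1 hRf h' h.1, hxK⟩,
        (hV.lift hfs hf' huf hg hfg).congr hV'f⟩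
    · exact ⟨uR, huR, (huR1 x hx).2 ⟨fun h' ↦ disjoint_left.1 hRf h.1 h', hxK⟩,
        (hU.lift hRs hf' huR (mapsTo_univ _ _) hgR).congr hV'R⟩
    · exact (hxK (htubeK h)).elim
  · have hxd : x ∈ disk := sphere_subset_closedBall hx
    have hyd : y ∈ disk := sphere_subset_closedBall hy
    have hxf : f' x ∈ f '' sphere 0 1 := ⟨y, hy, hxy.symm⟩
    -- A boundary point lies neither on the sphere nor in the box, so near it the frame is that of
    -- Δ.
    have hxu : x ∈ disk ∩ uf := ⟨hxd, (huf1 x hxd).2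
      ⟨fun h ↦ disjoint_left.1 hRf h ⟨y, hyd, hxy.symm⟩,
        fun h ↦ disjoint_left.1 hΨd (hKtarget h) hxf⟩⟩
    have hgy : g x = y := hf.injOn (hg hxu) hyd ((hfg x hxu).trans hxy)
    refine ⟨fun i ↦ by rw [hV'f i x hxu, hgy], ?_⟩
    rw [hfs.range_differential_lift hf' huf hg hfg hxu, hgy]

end Tube

/-! ### Transferring framings between disks with the same boundary -/

section Admissible

variable {H W H' Y : Type*}
  [TopologicalSpace H] {I : ModelWithCorners ℝ (Euc 5) H}
  [TopologicalSpace W] [ChartedSpace H W] [IsManifold I ∞ W]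
  [TopologicalSpace H'] {J : ModelWithCorners ℝ (Euc 3) H'}
  [TopologicalSpace Y] [ChartedSpace H' Y]

theorem contDiffOn_direction : ContDiffOn ℝ ∞ direction {0}ᶜ :=
  ((contDiffOn_id.norm ℝ fun _ hx ↦ hx).inv
    fun x (hx : x ≠ 0) ↦ norm_ne_zero_iff.2 hx).smul contDiffOn_id

theorem direction_mem_sphere {x : Euc 2} (hx : x ≠ 0) : direction x ∈ sphere (0 : Euc 2) 1 := by
  rw [mem_sphere_zero_iff_norm, norm_direction hx]

theorem direction_of_mem_sphere {x : Euc 2} (hx : x ∈ sphere (0 : Euc 2) 1) : direction x = x := by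
  rw [mem_sphere_zero_iff_norm] at hx
  rw [direction, hx, inv_one, one_smul]

/-- The reparametrization of the common boundary of two embedded disks extends to a smooth map
between the disks. -/
theorem exists_smooth_extension [T2Space W] {f f' : Euc 2 → W} (hf : IsEmbeddedDisk I f)
    (hf' : IsEmbeddedDisk I f') (hbd : f' '' sphere 0 1 ⊆ f '' sphere 0 1) :
    ∃ h : Euc 2 → Euc 2, ContDiff ℝ ∞ h ∧ (∀ x, h x ∈ disk) ∧
      ∀ x ∈ sphere (0 : Euc 2) 1, h x ∈ sphere (0 : Euc 2) 1 ∧ f (h x) = f' x := by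
  -- The change of boundary parameter is extended to be constant on rays, and is then multiplied by
  -- a cutoff to become smooth at the origin.
  let σ : Euc 2 → Euc 2 := fun x ↦ Function.invFunOn f (sphere 0 1) (f' (direction x))
  have hmem : ∀ x ≠ 0, f' (direction x) ∈ f '' sphere 0 1 := fun x hx ↦
    hbd ⟨_, direction_mem_sphere hx, rfl⟩
  have hσ1 : ∀ x ≠ 0, σ x ∈ sphere (0 : Euc 2) 1 := fun x hx ↦ Function.invFunOn_mem (hmem x hx)
  have hσ2 : ∀ x ≠ 0, f (σ x) = f' (direction x) := fun x hx ↦ Function.invFunOn_eq (hmem x hx)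
  have hσ : ContDiffOn ℝ ∞ σ {0}ᶜ := by
    have h0 : MapsTo direction ({0}ᶜ : Set (Euc 2)) disk := fun x hx ↦
      sphere_subset_closedBall (direction_mem_sphere hx)
    have h1 : ContMDiffOn 𝓘(ℝ, Euc 2) I ∞ (f' ∘ direction) {0}ᶜ :=
      hf'.smooth.comp contDiffOn_direction.contMDiffOn h0
    have h2 : MapsTo σ {0}ᶜ disk := fun x hx ↦ sphere_subset_closedBall (hσ1 x hx)
    have h3 : ContMDiffOn 𝓘(ℝ, Euc 2) 𝓘(ℝ, Euc 2) ∞ σ {0}ᶜ :=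
      hf.isSurface.contMDiffOn_lift isOpen_compl_singleton.uniqueDiffOn h2 h1 hσ2
    exact h3.contDiffOn
  -- `ρ` vanishes for `‖x‖² ≤ 1/2` and is 1 for `‖x‖² ≥ 3/4`.
  let ρ : Euc 2 → ℝ := fun x ↦ Real.smoothTransition (4 * ‖x‖ ^ 2 - 2)
  have hρ : ContDiff ℝ ∞ ρ := Real.smoothTransition.contDiff.comp
    ((contDiff_const.mul (contDiff_norm_sq ℝ)).sub contDiff_const)
  refine ⟨fun x ↦ ρ x • σ x, contDiff_iff_contDiffAt.2 fun x ↦ ?_, fun x ↦ ?_, fun x hx ↦ ?_⟩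
  · by_cases hx : x = 0
    · subst hx
      have : (fun x ↦ ρ x • σ x) =ᶠ[𝓝 0] fun _ ↦ 0 := by
        filter_upwards [ball_mem_nhds (0 : Euc 2) (by norm_num : (0 : ℝ) < 1 / 2)] with y hy
        rw [mem_ball_zero_iff] at hy
        have h0 : ρ y = 0 := Real.smoothTransition.zero_of_nonpos (by nlinarith [norm_nonneg y])
        rw [h0, zero_smul]
      exact contDiffAt_const.congr_of_eventuallyEq this
    · exact hρ.contDiffAt.smul (hσ.contDiffAt (isOpen_compl_singleton.mem_nhds hx))
  · by_cases hx : x = 0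
    · have h0 : ρ x = 0 := Real.smoothTransition.zero_of_nonpos (by simp [hx])
      simp [h0]
    · have h1 := hσ1 x hx
      rw [mem_sphere_zero_iff_norm] at h1
      rw [mem_closedBall_zero_iff, norm_smul, h1, mul_one, Real.norm_eq_abs,
        abs_of_nonneg (Real.smoothTransition.nonneg _)]
      exact Real.smoothTransition.le_one _
  · have hx0 : x ≠ 0 := by
      rintro rfl
      simp at hx
    have h1 : ρ x = 1 := Real.smoothTransition.one_of_one_le (by
      rw [mem_sphere_zero_iff_norm] at hx
      rw [hx]; norm_num)
    simp only [h1, one_smul]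
    refine ⟨hσ1 x hx0, ?_⟩
    rw [hσ2 x hx0, direction_of_mem_sphere hx]

/-- Admissibility only depends on the restriction of a normal frame of the disk to the boundary. -/
theorem IsAdmissible.of_isNormalFrame [T2Space W] {ι : Y → W} {γ : Circ → Y} {f f' : Euc 2 → W}
    (hf : IsEmbeddedDisk I f) (hf' : IsEmbeddedDisk I f')
    (hbd : f' '' sphere 0 1 ⊆ f '' sphere 0 1) {V V' : Fin 3 → Euc 2 → Euc 5}
    (hV : IsNormalFrame I f disk disk V) (hV' : IsNormalFrame I f' disk disk V')
    (hVV' : ∀ x ∈ sphere (0 : Euc 2) 1, ∀ y ∈ sphere (0 : Euc 2) 1, f' x = f y →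
        (∀ i, V' i x = V i y) ∧
        LinearMap.range (differential 𝓘(ℝ, Euc 2) I f' disk x).toLinearMap =
          LinearMap.range (differential 𝓘(ℝ, Euc 2) I f disk y).toLinearMap)
    {φ : NormalPair J γ} (h : IsAdmissible J I ι γ f φ) : IsAdmissible J I ι γ f' φ := by
  obtain ⟨B, Φ, hΦ, hext⟩ := h
  obtain ⟨U, hU, hΦU⟩ : ∃ U : Fin 2 → Euc 2 → Euc 5,
      (∀ j, SmoothAlong 𝓘(ℝ, Euc 2) I f (U j) disk) ∧ ∀ j, ∀ x ∈ disk,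
        Φ j x = Submodule.Quotient.mk (show TangentSpace I (f x) from U j x) := by
    choose U hU hΦU using hΦ.smooth
    exact ⟨U, hU, hΦU⟩
  choose A b hA hb hAU using fun j ↦ hV.exists_coefficients hf Subset.rfl (hU j)
  obtain ⟨k, hk, hkd, hks⟩ := exists_smooth_extension hf hf' hbd
  -- The coefficients are pulled back by `k`, which need not be a diffeomorphism: independence at
  -- `x` only uses independence of `Φ` at `k x`. The tangential coefficients are dropped, as only
  -- classes modulo tangent vectors matter.
  let U' : Fin 2 → Euc 2 → Euc 5 := fun j x ↦ ∑ i, A j i (k x) • V' i x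
  have hU' : ∀ j, SmoothAlong 𝓘(ℝ, Euc 2) I f' (U' j) disk := fun j ↦
    SmoothAlong.sum hf'.smooth _ fun i _ ↦ SmoothAlong.smul
      (((hA j i).comp hk.contDiffOn fun x _ ↦ hkd x).contMDiffOn) (hV'.smooth i)
  let Φ' : Fin 2 → ∀ x, NormalSpace 𝓘(ℝ, Euc 2) I f' disk x := fun j x ↦
    Submodule.Quotient.mk (show TangentSpace I (f' x) from U' j x)
  refine ⟨fun x ↦ Submodule.span ℝ (range fun j ↦ Φ' j x), Φ',
    ⟨fun j ↦ ⟨U' j, hU' j, fun x _ ↦ rfl⟩, fun x hx ↦ ?_, fun _ _ ↦ rfl⟩, ?_⟩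
  · rw [Fintype.linearIndependent_iff]
    intro c hc
    have hc' := (Submodule.Quotient.mk_eq_zero _).1 ((sum_smul_quotient_mk _ c _).symm.trans hc)
    obtain ⟨d, hd⟩ := hc'
    have h1 : ∑ i, (∑ j, c j * A j i (k x)) • V' i x =
        differential 𝓘(ℝ, Euc 2) I f' disk x d := by
      refine Eq.trans ?_ hd.symm
      change _ = ∑ j, c j • ∑ i, A j i (k x) • V' i x
      simp only [Finset.smul_sum, Finset.sum_smul, smul_smul]
      exact Finset.sum_comm
    have h2 : ∀ i, ∑ j, c j * A j i (k x) = 0 := fun i ↦ congrFun (hV'.eq_zero x hx _ _ h1) i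
    refine Fintype.linearIndependent_iff.1 (hΦ.linearIndependent (k x) (hkd x)) c ?_
    refine (Finset.sum_congr rfl fun j _ ↦ congrArg (c j • ·) (hΦU j (k x) (hkd x))).trans
      ((sum_smul_quotient_mk _ c _).trans ?_)
    refine (Submodule.Quotient.mk_eq_zero _).2
      ⟨∑ l, (∑ j, c j * b j l (k x)) • EuclideanSpace.basisFun (Fin 2) ℝ l, ?_⟩
    refine (sum_smul_partialField (I := I) f (fun l ↦ ∑ j, c j * b j l (k x)) (k x)).symm.trans ?_
    have h3 : ∑ j, c j • U j (k x) =
        ∑ i, (∑ j, c j * A j i (k x)) • V i (k x) +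
          ∑ l, (∑ j, c j * b j l (k x)) • partialField I f l (k x) := by
      simp only [fun j ↦ hAU j (k x) (hkd x)]
      simp only [smul_add, Finset.smul_sum, Finset.sum_add_distrib, smul_smul, Finset.sum_smul]
      congr 1 <;> exact Finset.sum_comm
    refine Eq.trans ?_ h3.symm
    simp [h2]
  · intro x hx θ hxθ i v hv
    obtain ⟨hks1, hks2⟩ := hks x hx
    obtain ⟨h1, h2⟩ := hVV' x hx (k x) hks1 hks2.symm
    have h3 := hext (k x) hks1 θ (hks2.trans hxθ) i v hv
    rw [hΦU i (k x) (hkd x)] at h3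
    let w : Euc 5 := mfderiv J I ι (γ θ) v
    have h4 : U i (k x) - w ∈
        LinearMap.range (differential 𝓘(ℝ, Euc 2) I f disk (k x)).toLinearMap :=
      (Submodule.Quotient.eq _).1 h3
    refine (Submodule.Quotient.eq _).2 ?_
    change U' i x - w ∈
      LinearMap.range (differential 𝓘(ℝ, Euc 2) I f' disk x).toLinearMap
    rw [h2]
    -- On the boundary the two frames and the two tangent planes agree, so the new field differs
    -- from the old one by a tangent vector.
    have h5 : U' i x = U i (k x) - ∑ l, b i l (k x) • partialField I f l (k x) := by
      rw [hAU i (k x) (hkd x)]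
      simp [U', h1]
    rw [h5, sub_right_comm]
    refine Submodule.sub_mem _ h4 ?_
    rw [sum_smul_partialField]
    exact ⟨_, rfl⟩

end Admissible

end Tubing

theorem lemma5p4
    {H W H' Y : Type*}
    [TopologicalSpace H] {I : ModelWithCorners ℝ (Euc 5) H}
    [TopologicalSpace W] [T2Space W] [ChartedSpace H W] [IsManifold I ∞ W]
    [TopologicalSpace H'] {J : ModelWithCorners ℝ (Euc 3) H'}
    [TopologicalSpace Y] [ChartedSpace H' Y] [IsManifold J ∞ Y]
    (ι : Y → W) (hι : Manifold.IsSmoothEmbedding J I ∞ ι)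
    (γ : Circ → Y) (hγ : Manifold.IsSmoothEmbedding (𝓡 1) J ∞ γ)
    (Δ : Euc 2 → W) (hΔ : IsSpanningDisk I ι γ Δ)
    (R : Sph → W) (hR : Manifold.IsSmoothEmbedding (𝓡 2) I ∞ R)
    (hRtriv : HasTrivialNormalBundle (𝓡 2) I 3 R)
    (hRΔ : Disjoint (range R) (Δ '' disk)) (hRY : Disjoint (range R) (range ι))
    (Δ' : Euc 2 → W) (htube : IsTubing I Δ R Δ') (hΔ' : IsSpanningDisk I ι γ Δ')
    (φ : NormalPair J γ) (hφ : IsFraming (𝓡 1) J γ univ (fun _ ↦ ⊤) φ) :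
    IsAdmissible J I ι γ Δ φ ↔ IsAdmissible J I ι γ Δ' φ := by
  obtain ⟨V, hV⟩ := hΔ.embedded.exists_isNormalFrame
  obtain ⟨V', hV', h⟩ := htube.exists_isNormalFrame hΔ.embedded hR hRtriv hRΔ hV
  have hbd : Δ' '' sphere 0 1 = Δ '' sphere 0 1 := htube.2.1
  -- Agreement along the boundary is symmetric in the two disks, so the same transfer gives both
  -- directions.
  exact ⟨fun hadm ↦ hadm.of_isNormalFrame hΔ.embedded hΔ'.embedded hbd.subset hV hV' h,
    fun hadm ↦ hadm.of_isNormalFrame hΔ'.embedded hΔ.embedded hbd.symm.subset hV' hV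
      fun x hx y hy hxy ↦ ⟨fun i ↦ ((h y hy x hx hxy.symm).1 i).symm,
        (h y hy x hx hxy.symm).2.symm⟩⟩
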